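/- Let $(\mathcal S,\langle\cdot,\cdot\rangle)$ be a connected, finite-dimensional, complete smooth Riemannian manifold without boundary, let $\delta$ be a smooth vector field on $\mathcal S$ and $\beta:\mathcal S\to(0,\infty)$ a smooth function. Consider the standard stationary spacetime $\mathcal M=\mathcal S\times\mathbb R$ with the Lorentzian metric $$\langle\cdot,\cdot\rangle_L=\langle\cdot,\cdot\rangle+2\langle\delta(x),\cdot\rangle\,dt-\beta(x)\,dt^2 ,$$ time-oriented so that the complete timelike Killing vector field $K=\partial_t$ is future-directed, and assume that $\mathcal S\times\{0\}$ is a Cauchy hypersurface of $\mathcal M$, that is, every inextendible (piecewise $C^1$) timelike curve crosses it exactly once. For $p=(x_p,t_p)$, $q=(x_q,t_q)\in\mathcal M$ let $C^1_K(p,q)$ be the set of $C^1$ curves $z:[0,1]\to\mathcal M$ with $z(0)=p$, $z(1)=q$ such that $\langle\dot z,K(z)\rangle_L$ is constant on $[0,1]$, and let $f(z)=\frac12\int_0^1\langle\dot z,\dot z\rangle_L\,ds$. Let $(z_n)_n$, $z_n=(x_n,t_n)$, be a sequence of curves in $C^1_K(p,q)$ such that $f(z_n)$ is bounded above uniformly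 in $n$. Then the sequence of norms $\|\dot x_n\|=\left(\int_0^1\langle\dot x_n,\dot x_n\rangle\,ds\right)^{1/2}$ is bounded. Moreover, $f(z_n)=\mathcal J(x_n)$ for all $n$, where, with $\Delta_t=t_q-t_p$, $$\mathcal J(x)=\frac12\int_0^1\langle\dot x,\dot x\rangle\,ds+\frac12\int_0^1\frac{\langle\delta(x),\dot x\rangle^2}{\beta(x)}\,ds-\frac12\left(\int_0^1\frac{\langle\delta(x),\dot x\rangle}{\beta(x)}\,ds-\Delta_t\right)^2\left(\int_0^1\frac{ds}{\beta(x)}\right)^{-1}.$$ -/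

import Mathlib

open Set Filter Topology Bundle Manifold
open scoped ContDiff

noncomputable section

namespace Stationary

variable {E : Type*} [NormedAddCommGroup E] [NormedSpace ℝ E]
  {S : Type*} [TopologicalSpace S] [ChartedSpace E S]

/-- The model with corners of the product manifold `S × ℝ`, where `S` is a boundaryless manifold
modelled on `E`. -/
abbrev model (E : Type*) [NormedAddCommGroup E] [NormedSpace ℝ E] :
    ModelWithCorners ℝ (E × ℝ) (ModelProd E ℝ) :=
  𝓘(ℝ, E).prod 𝓘(ℝ, ℝ)

/-- The component in `T_x S` of a tangent vector of `S × ℝ` at `(x, t)`, under the identification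
`T_(x,t) (S × ℝ) = T_x S × ℝ`. -/
def spatialPart (z : S × ℝ) (v : TangentSpace (model E) z) : TangentSpace 𝓘(ℝ, E) z.1 :=
  Prod.fst (α := E) (β := ℝ) v

/-- The component `dt(v)` of a tangent vector `v` of `S × ℝ`. -/
def timePart (z : S × ℝ) (v : TangentSpace (model E) z) : ℝ :=
  Prod.snd (α := E) (β := ℝ) v

/-- The vector field `K = ∂_t` on `S × ℝ`. -/
def killing (z : S × ℝ) : TangentSpace (model E) z :=
  ((0 : E), (1 : ℝ))

section Metric

variable [RiemannianBundle (fun x : S ↦ TangentSpace 𝓘(ℝ, E) x)]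

/-- The polarization of the standard stationary metric
`⟨·,·⟩_L = ⟨·,·⟩ + 2 ⟨δ(x),·⟩ dt - β(x) dt²` on `S × ℝ`. -/
def lorentz (δ : (x : S) → TangentSpace 𝓘(ℝ, E) x) (β : S → ℝ) (z : S × ℝ)
    (v w : TangentSpace (model E) z) : ℝ :=
  inner ℝ (spatialPart z v) (spatialPart z w)
    + inner ℝ (δ z.1) (spatialPart z v) * timePart z w
    + inner ℝ (δ z.1) (spatialPart z w) * timePart z v
    - β z.1 * (timePart z v * timePart z w)

/-- The open cone of future-directed timelike vectors at `z`; the time-orientation is the one for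
which `∂_t` is future-directed. -/
def futureCone (δ : (x : S) → TangentSpace 𝓘(ℝ, E) x) (β : S → ℝ) (z : S × ℝ) :
    Set (TangentSpace (model E) z) :=
  {v | lorentz δ β z v v < 0 ∧ lorentz δ β z v (killing z) < 0}

/-- The open cone of past-directed timelike vectors at `z`. -/
def pastCone (δ : (x : S) → TangentSpace 𝓘(ℝ, E) x) (β : S → ℝ) (z : S × ℝ) :
    Set (TangentSpace (model E) z) :=
  {v | lorentz δ β z v v < 0 ∧ 0 < lorentz δ β z v (killing z)}

end Metric

/-- The velocity in `T (S × ℝ)` at `s` of a curve `γ` considered on `[a, b]` (one-sided at the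
end points). -/
def velocity (γ : ℝ → S × ℝ) (a b s : ℝ) : TangentSpace (model E) (γ s) :=
  mfderivWithin 𝓘(ℝ, ℝ) (model E) γ (Icc a b) s (1 : ℝ)

/-- The velocity in `T S` at `s` of a curve `x` in `S` considered on `[0, 1]`. -/
def spatialVelocity (x : ℝ → S) (s : ℝ) : TangentSpace 𝓘(ℝ, E) (x s) :=
  mfderivWithin 𝓘(ℝ, ℝ) 𝓘(ℝ, E) x (Icc 0 1) s (1 : ℝ)

/-- `γ` restricted to `[a, b]` is piecewise `C¹` and all its velocities (both one-sided velocities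
at each break) lie in the given family of cones. -/
def IsPiecewiseInCone (C : (z : S × ℝ) → Set (TangentSpace (model E) z)) (γ : ℝ → S × ℝ)
    (a b : ℝ) : Prop :=
  ∃ (n : ℕ) (σ : ℕ → ℝ), StrictMono σ ∧ σ 0 = a ∧ σ n = b ∧ ∀ i < n,
    ContMDiffOn 𝓘(ℝ, ℝ) (model E) 1 γ (Icc (σ i) (σ (i + 1))) ∧
    ∀ s ∈ Icc (σ i) (σ (i + 1)), velocity γ (σ i) (σ (i + 1)) s ∈ C (γ s)

/-- `γ`, defined on the interval `I`, has no end point in `S × ℝ` in either direction. An interval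
which contains one of its bounds is excluded automatically. -/
def IsInextendible (γ : ℝ → S × ℝ) (I : Set ℝ) : Prop :=
  (∀ p, ¬ Tendsto (fun s : I ↦ γ s) atTop (𝓝 p)) ∧
  (∀ p, ¬ Tendsto (fun s : I ↦ γ s) atBot (𝓝 p))

variable [RiemannianBundle (fun x : S ↦ TangentSpace 𝓘(ℝ, E) x)]

/-- `γ : I → S × ℝ` is a piecewise `C¹` timelike curve, future-directed or past-directed. On an
arbitrary interval `I`, piecewise means on each compact subinterval. -/
def IsTimelikeCurve (δ : (x : S) → TangentSpace 𝓘(ℝ, E) x) (β : S → ℝ) (γ : ℝ → S × ℝ)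
    (I : Set ℝ) : Prop :=
  I.OrdConnected ∧
  ((∀ a ∈ I, ∀ b ∈ I, a < b → IsPiecewiseInCone (futureCone δ β) γ a b) ∨
   (∀ a ∈ I, ∀ b ∈ I, a < b → IsPiecewiseInCone (pastCone δ β) γ a b))

/-- `A` is crossed exactly once by any inextendible timelike curve. -/
def IsCauchyHypersurface (δ : (x : S) → TangentSpace 𝓘(ℝ, E) x) (β : S → ℝ)
    (A : Set (S × ℝ)) : Prop :=
  ∀ (γ : ℝ → S × ℝ) (I : Set ℝ), IsTimelikeCurve δ β γ I → IsInextendible γ I →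
    ∃! s, s ∈ I ∧ γ s ∈ A

/-- The space `C¹_K(p, q)` of `C¹` curves `z : [0, 1] → S × ℝ` from `p` to `q` for which
`⟨ż, K(z)⟩_L` is constant. -/
def C1K (δ : (x : S) → TangentSpace 𝓘(ℝ, E) x) (β : S → ℝ) (p q : S × ℝ) :
    Set (ℝ → S × ℝ) :=
  {z | ContMDiffOn 𝓘(ℝ, ℝ) (model E) 1 z (Icc 0 1) ∧ z 0 = p ∧ z 1 = q ∧
    ∃ c : ℝ, ∀ s ∈ Icc (0 : ℝ) 1, lorentz δ β (z s) (velocity z 0 1 s) (killing (z s)) = c}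

/-- The action functional `f(z) = ½ ∫₀¹ ⟨ż, ż⟩_L ds`. -/
def action (δ : (x : S) → TangentSpace 𝓘(ℝ, E) x) (β : S → ℝ) (z : ℝ → S × ℝ) : ℝ :=
  (1 / 2) * ∫ s in (0 : ℝ)..1, lorentz δ β (z s) (velocity z 0 1 s) (velocity z 0 1 s)

/-- The functional `𝒥` on curves in `S`, with time difference `Δ`. -/
def reducedAction (δ : (x : S) → TangentSpace 𝓘(ℝ, E) x) (β : S → ℝ) (Δ : ℝ) (x : ℝ → S) : ℝ :=
  (1 / 2) * (∫ s in (0 : ℝ)..1, inner ℝ (spatialVelocity (E := E) x s) (spatialVelocity x s))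
    + (1 / 2) * (∫ s in (0 : ℝ)..1, (inner ℝ (δ (x s)) (spatialVelocity x s)) ^ 2 / β (x s))
    - (1 / 2) * ((∫ s in (0 : ℝ)..1, inner ℝ (δ (x s)) (spatialVelocity x s) / β (x s)) - Δ) ^ 2
      * (∫ s in (0 : ℝ)..1, 1 / β (x s))⁻¹

variable (E) in
/-- `‖ẋ‖ = (∫₀¹ ⟨ẋ, ẋ⟩ ds)^(1/2)`. -/
def velocityNorm (x : ℝ → S) : ℝ :=
  √(∫ s in (0 : ℝ)..1, inner ℝ (spatialVelocity (E := E) x s) (spatialVelocity x s))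

end Stationary

end

/-! Write g = ⟨ẋ,ẋ⟩, d = ⟨δ,ẋ⟩ and c for the constant ⟨ż,K⟩ = d − βṫ. Eliminating ṫ turns 2f into ∫g
+ ∫d²/β − c²∫1/β, and integrating ṫ = (d − c)/β gives c∫1/β = ∫d/β − Δ. Together these give f = 𝒥
(`integral_lorentz_eq_reduced`).

For the bound, 2f ≥ ∫g + 2cΔ, so only large |c| is a problem. Let M ≥ 0 bound the actions. If |c| ≥
1, the arithmetic-geometric mean inequality weighted by |c| gives ∫√(g/β + d²/β²) ≤ M + |c|∫1/β
(`integral_sqrt_le`), whose last term is ±(∫d/β − Δ). Depending on the sign of c, either x or its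
reversal thus has Fermat length at most M + |Δ|. So x stays in a forward ball of fixed radius about
one of its two fixed end points (`mem_forwardBall_of_action_le`). If such balls are relatively
compact, β and ‖δ‖/β are bounded there, |c| is at most affine in ∫|ẋ|, and Young's inequality
absorbs this term into the energy (`integral_sq_le`).

Relative compactness comes from the Cauchy hypersurface (`exists_isCompact_forwardBall_subset`). A
vector (v, τ) is future timelike as soon as τ exceeds the Fermat norm of v, so bounds on Fermat
length are bounds on the time needed to reach a point. If a ball of radius r is not relatively
compact, some point in it has a ball of radius 3r/4 that is not either. Iteration yields a
concatenated timelike curve of total duration at most 4r. It has no future end point, because small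
balls near a limit would be relatively compact. Extended to the past by a vertical half-line and
started early enough, it is inextendible and never meets time 0. -/

noncomputable section

namespace Stationary

/-! ### Velocities of curves, and concatenation of piecewise curves. -/

section Velocity

variable {E : Type*} [NormedAddCommGroup E] [NormedSpace ℝ E]
  {S : Type*} [TopologicalSpace S] [ChartedSpace E S]

/-- The velocity at `s` of a curve `x` considered on `[a, b]`, as a vector of the model space. -/
def curveVelocity (x : ℝ → S) (a b s : ℝ) : E :=
  mfderivWithin 𝓘(ℝ, ℝ) 𝓘(ℝ, E) x (Icc a b) s (1 : ℝ)

lemma uniqueMDiffOn_Icc {a b : ℝ} (h : a < b) : UniqueMDiffOn 𝓘(ℝ, ℝ) (Icc a b) :=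
  uniqueMDiffOn_iff_uniqueDiffOn.2 (uniqueDiffOn_Icc h)

lemma curveVelocity_congr {x y : ℝ → S} {a b s : ℝ} (h : EqOn x y (Icc a b))
    (hs : s ∈ Icc a b) : curveVelocity (E := E) x a b s = curveVelocity y a b s := by
  have := mfderivWithin_congr_of_mem (I := 𝓘(ℝ, ℝ)) (I' := 𝓘(ℝ, E)) h hs
  exact congrArg (fun L : ℝ →L[ℝ] E ↦ L 1) this

lemma curveVelocity_mono {x : ℝ → S} {a b c d s : ℝ} (hac : a ≤ c) (hcd : c < d) (hdb : d ≤ b)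
    (hs : s ∈ Icc c d) (hx : ContMDiffOn 𝓘(ℝ, ℝ) 𝓘(ℝ, E) 1 x (Icc a b)) :
    curveVelocity (E := E) x c d s = curveVelocity x a b s := by
  have hsub : Icc c d ⊆ Icc a b := Icc_subset_Icc hac hdb
  have := mfderivWithin_subset (I := 𝓘(ℝ, ℝ)) (I' := 𝓘(ℝ, E)) hsub (uniqueMDiffOn_Icc hcd s hs)
    (hx.mdifferentiableOn one_ne_zero s (hsub hs))
  exact congrArg (fun L : ℝ →L[ℝ] E ↦ L 1) this

lemma curveVelocity_comp_affine {x : ℝ → S} {a b c d s : ℝ} (k m : ℝ) (hab : a < b)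
    (hmaps : MapsTo (fun s ↦ k * s + m) (Icc a b) (Icc c d)) (hs : s ∈ Icc a b)
    (hx : ContMDiffOn 𝓘(ℝ, ℝ) 𝓘(ℝ, E) 1 x (Icc c d)) :
    curveVelocity (E := E) (fun s ↦ x (k * s + m)) a b s
      = k • curveVelocity (E := E) x c d (k * s + m) := by
  have hφ : HasDerivWithinAt (fun s : ℝ ↦ k * s + m) k (Icc a b) s := by
    simpa using (((hasDerivAt_id s).const_mul k).add_const m).hasDerivWithinAt
  have h := mfderivWithin_comp (I := 𝓘(ℝ, ℝ)) (I' := 𝓘(ℝ, ℝ)) (I'' := 𝓘(ℝ, E))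
    (f := fun s : ℝ ↦ k * s + m) (g := x) s
    (hx.mdifferentiableOn one_ne_zero _ (hmaps hs))
    (mdifferentiableWithinAt_iff_differentiableWithinAt.2 hφ.differentiableWithinAt)
    hmaps (uniqueMDiffOn_Icc hab s hs)
  have h2 := congrArg (fun L : ℝ →L[ℝ] E ↦ L 1) h
  have h3 : mfderivWithin 𝓘(ℝ, ℝ) 𝓘(ℝ, ℝ) (fun s : ℝ ↦ k * s + m) (Icc a b) s (1 : ℝ) = k := by
    rw [mfderivWithin_eq_fderivWithin]
    exact hφ.derivWithin (uniqueDiffOn_Icc hab s hs)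
  have h4 : ∀ L : ℝ →L[ℝ] E, L k = k • L 1 := fun L ↦ by
    rw [← L.map_smul]; simp
  refine h2.trans ?_
  exact (congrArg (mfderivWithin 𝓘(ℝ, ℝ) 𝓘(ℝ, E) x (Icc c d) (k * s + m) : ℝ →L[ℝ] E) h3).trans
    (h4 _)

lemma contMDiffOn_comp_affine {x : ℝ → S} {a b c d : ℝ} (k m : ℝ)
    (hmaps : MapsTo (fun s ↦ k * s + m) (Icc a b) (Icc c d))
    (hx : ContMDiffOn 𝓘(ℝ, ℝ) 𝓘(ℝ, E) 1 x (Icc c d)) :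
    ContMDiffOn 𝓘(ℝ, ℝ) 𝓘(ℝ, E) 1 (fun s ↦ x (k * s + m)) (Icc a b) := by
  refine hx.comp (f := fun s ↦ k * s + m) ?_ hmaps
  rw [contMDiffOn_iff_contDiffOn]
  fun_prop

lemma velocity_prodMk {x : ℝ → S} {t : ℝ → ℝ} {a b s : ℝ} (hab : a < b) (hs : s ∈ Icc a b)
    (hx : ContMDiffOn 𝓘(ℝ, ℝ) 𝓘(ℝ, E) 1 x (Icc a b)) (ht : ContDiffOn ℝ 1 t (Icc a b)) :
    velocity (E := E) (fun s ↦ (x s, t s)) a b s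
      = (curveVelocity (E := E) x a b s, derivWithin t (Icc a b) s) := by
  have h := mfderivWithin_prodMk (I := 𝓘(ℝ, ℝ)) (I' := 𝓘(ℝ, E)) (I'' := 𝓘(ℝ, ℝ))
    (hx.mdifferentiableOn one_ne_zero s hs)
    (mdifferentiableWithinAt_iff_differentiableWithinAt.2 (ht.differentiableOn one_ne_zero s hs))
    (uniqueMDiffOn_Icc hab s hs)
  have h2 := congrArg (fun L : ℝ →L[ℝ] E × ℝ ↦ L 1) h
  refine h2.trans ?_
  rw [← fderivWithin_derivWithin, ← mfderivWithin_eq_fderivWithin]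
  rfl

lemma continuousOn_curveVelocity [IsManifold 𝓘(ℝ, E) 1 S] {x : ℝ → S} {a b : ℝ} (hab : a < b)
    (hx : ContMDiffOn 𝓘(ℝ, ℝ) 𝓘(ℝ, E) 1 x (Icc a b)) :
    ContinuousOn (fun s ↦ (⟨x s, curveVelocity (E := E) x a b s⟩ : TangentBundle 𝓘(ℝ, E) S))
      (Icc a b) := by
  have h := hx.continuousOn_tangentMapWithin le_rfl (uniqueMDiffOn_Icc hab)
  -- The lifted curve is the tangent map applied to the unit section of `Tℝ`.
  have h1 : Continuous (fun s : ℝ ↦ (⟨s, (1 : ℝ)⟩ : TangentBundle 𝓘(ℝ, ℝ) ℝ)) := by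
    have := (tangentBundleModelSpaceHomeomorph 𝓘(ℝ, ℝ)).symm.continuous.comp
      (f := fun s : ℝ ↦ ((s, 1) : ModelProd ℝ ℝ)) (by
        exact Continuous.prodMk continuous_id continuous_const)
    exact this
  exact h.comp h1.continuousOn (fun s hs ↦ hs)

lemma IsPiecewiseInCone.trans {C : (z : S × ℝ) → Set (TangentSpace (model E) z)}
    {γ : ℝ → S × ℝ} {a b c : ℝ} (h : IsPiecewiseInCone C γ a b)
    (h' : IsPiecewiseInCone C γ b c) : IsPiecewiseInCone C γ a c := by
  obtain ⟨n, σ, hσ, hσ0, hσn, hσC⟩ := h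
  obtain ⟨m, ρ, hρ, hρ0, hρm, hρC⟩ := h'
  -- At `i = n` the two branches agree, since `σ n = b = ρ 0`.
  have key : ∀ i, n ≤ i → (if i ≤ n then σ i else ρ (i - n)) = ρ (i - n) := fun i hi ↦ by
    split_ifs with h
    · obtain rfl := le_antisymm h hi
      simp [hσn, hρ0]
    · rfl
  refine ⟨n + m, fun i ↦ if i ≤ n then σ i else ρ (i - n), strictMono_nat_of_lt_succ fun i ↦ ?_,
    by simp [hσ0],
    (key _ (Nat.le_add_right n m)).trans (by simpa using hρm), fun i hi ↦ ?_⟩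
  · rcases lt_or_ge i n with hin | hin
    · simpa only [hin.le, Nat.succ_le_of_lt hin, if_true] using hσ (Nat.lt_succ_self i)
    · rw [key i hin, key (i + 1) (by omega)]
      exact hρ (by omega)
  · rcases lt_or_ge i n with hin | hin
    · simpa only [hin.le, Nat.succ_le_of_lt hin, if_true] using hσC i hin
    · simp only [key i hin, key (i + 1) (by omega)]
      rw [show i + 1 - n = (i - n) + 1 by omega]
      exact hρC (i - n) (by omega)

end Velocity

/-! ### The future cone and the Fermat metric. -/

section Vectors

variable {E : Type*} [NormedAddCommGroup E] [NormedSpace ℝ E]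
  {S : Type*} [TopologicalSpace S] [ChartedSpace E S]
  [RiemannianBundle (fun x : S ↦ TangentSpace 𝓘(ℝ, E) x)]

/-- The Riemannian norm of a vector at `x`, given by its representative in the model space. -/
def speed (x : S) (v : E) : ℝ := norm (E := TangentSpace 𝓘(ℝ, E) x) v

/-- The scalar product `⟨δ(x), v⟩`. -/
def shift (δ : (x : S) → TangentSpace 𝓘(ℝ, E) x) (x : S) (v : E) : ℝ :=
  inner ℝ (δ x) (v : TangentSpace 𝓘(ℝ, E) x)

/-- The Fermat metric `⟨δ, v⟩ / β + √(⟨v, v⟩ / β + ⟨δ, v⟩² / β²)`. -/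
def fermat (δ : (x : S) → TangentSpace 𝓘(ℝ, E) x) (β : S → ℝ) (x : S) (v : E) : ℝ :=
  shift δ x v / β x + √(speed x v ^ 2 / β x + (shift δ x v / β x) ^ 2)

/-- The vector `(v, τ)` at `(x, t)` is future-directed timelike. -/
def IsFutureVector (δ : (x : S) → TangentSpace 𝓘(ℝ, E) x) (β : S → ℝ) (x : S) (v : E)
    (τ : ℝ) : Prop :=
  speed x v ^ 2 + 2 * shift δ x v * τ < β x * τ ^ 2 ∧ shift δ x v < β x * τ

variable {δ : (x : S) → TangentSpace 𝓘(ℝ, E) x} {β : S → ℝ}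

lemma speed_nonneg (x : S) (v : E) : 0 ≤ speed x v :=
  norm_nonneg (E := TangentSpace 𝓘(ℝ, E) x) v

lemma speed_smul (x : S) (k : ℝ) (v : E) : speed x (k • v) = |k| * speed x v :=
  norm_smul (β := TangentSpace 𝓘(ℝ, E) x) k v

lemma shift_smul (x : S) (k : ℝ) (v : E) : shift δ x (k • v) = k * shift δ x v :=
  real_inner_smul_right (F := TangentSpace 𝓘(ℝ, E) x) _ v k

lemma speed_sq (x : S) (v : E) :
    speed x v ^ 2 = inner (E := TangentSpace 𝓘(ℝ, E) x) ℝ v v :=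
  (real_inner_self_eq_norm_sq (F := TangentSpace 𝓘(ℝ, E) x) v).symm

lemma abs_shift_le (x : S) (v : E) : |shift δ x v| ≤ ‖δ x‖ * speed x v :=
  abs_real_inner_le_norm (F := TangentSpace 𝓘(ℝ, E) x) (δ x) v

lemma lorentz_eq (z : S × ℝ) (v w : E) (τ σ : ℝ) :
    lorentz δ β z ((v, τ) : E × ℝ) ((w, σ) : E × ℝ)
      = inner (E := TangentSpace 𝓘(ℝ, E) z.1) ℝ v w
        + shift δ z.1 v * σ + shift δ z.1 w * τ - β z.1 * (τ * σ) := rfl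

lemma lorentz_self (z : S × ℝ) (v : E) (τ : ℝ) :
    lorentz δ β z ((v, τ) : E × ℝ) ((v, τ) : E × ℝ)
      = speed z.1 v ^ 2 + 2 * shift δ z.1 v * τ - β z.1 * τ ^ 2 := by
  rw [lorentz_eq, speed_sq]; ring

lemma lorentz_killing (z : S × ℝ) (v : E) (τ : ℝ) :
    lorentz δ β z ((v, τ) : E × ℝ) (killing z) = shift δ z.1 v - β z.1 * τ := by
  have h := lorentz_eq (δ := δ) (β := β) z v 0 τ 1
  have h1 : inner (E := TangentSpace 𝓘(ℝ, E) z.1) ℝ v (0 : E) = 0 :=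
    inner_zero_right (E := TangentSpace 𝓘(ℝ, E) z.1) v
  have h2 : shift δ z.1 (0 : E) = 0 := inner_zero_right (E := TangentSpace 𝓘(ℝ, E) z.1) (δ z.1)
  rw [h1, h2] at h
  refine h.trans ?_
  ring

lemma mem_futureCone_iff (z : S × ℝ) (v : E) (τ : ℝ) :
    ((v, τ) : E × ℝ) ∈ futureCone δ β z ↔ IsFutureVector δ β z.1 v τ := by
  have : ((v, τ) : E × ℝ) ∈ futureCone δ β z ↔ lorentz δ β z ((v, τ) : E × ℝ) ((v, τ) : E × ℝ) < 0 ∧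
    lorentz δ β z ((v, τ) : E × ℝ) (killing z) < 0 := Iff.rfl
  rw [this, lorentz_self, lorentz_killing, IsFutureVector, sub_neg, sub_neg]

lemma IsFutureVector.pos {x : S} {v : E} {τ : ℝ} (h : IsFutureVector δ β x v τ)
    (hβ : 0 < β x) : 0 < τ := by
  by_contra! hτ
  nlinarith [h.1, mul_nonneg_of_nonpos_of_nonpos (sub_nonpos.2 h.2.le) hτ, sq_nonneg (speed x v),
    mul_nonneg hβ.le (sq_nonneg τ)]

lemma IsFutureVector.smul {x : S} {v : E} {τ k : ℝ} (h : IsFutureVector δ β x v τ)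
    (hk : 0 < k) : IsFutureVector δ β x (k • v) (k * τ) := by
  refine ⟨?_, ?_⟩
  · rw [speed_smul, shift_smul, abs_of_pos hk]
    nlinarith [mul_lt_mul_of_pos_left h.1 (pow_pos hk 2)]
  · rw [shift_smul]
    nlinarith [mul_lt_mul_of_pos_left h.2 hk]

lemma isFutureVector_zero {x : S} {τ : ℝ} (hβ : 0 < β x) (hτ : 0 < τ) :
    IsFutureVector δ β x (0 : E) τ := by
  have h1 : shift δ x (0 : E) = 0 := by simpa using shift_smul (δ := δ) x 0 (0 : E)
  have h2 : speed x (0 : E) = 0 := by simpa using speed_smul x 0 (0 : E)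
  exact ⟨by rw [h1, h2]; nlinarith [mul_pos hβ (pow_pos hτ 2)], by rw [h1]; exact mul_pos hβ hτ⟩

/-- If the speed exceeded this bound it would also exceed `τ`, and its square would dominate
`2‖δ‖τ|v| + βτ²`, contrary to timelikeness. -/
lemma IsFutureVector.speed_le {x : S} {v : E} {τ : ℝ} (h : IsFutureVector δ β x v τ)
    (hβ : 0 < β x) : speed x v ≤ (2 * ‖δ x‖ + β x + 1) * τ := by
  have hτ := h.pos hβ
  by_contra! hv
  have h1 := abs_le.1 (abs_shift_le (δ := δ) x v)
  have hD := norm_nonneg (δ x)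
  have hτv : τ ≤ speed x v := by nlinarith [mul_nonneg hD hτ.le, mul_nonneg hβ.le hτ.le]
  have h2 : (2 * ‖δ x‖ + β x + 1) * τ * speed x v ≤ speed x v * speed x v :=
    mul_le_mul_of_nonneg_right hv.le (speed_nonneg x v)
  have h3 := mul_le_mul_of_nonneg_left hτv (mul_nonneg hβ.le hτ.le)
  have h4 := mul_le_mul_of_nonneg_right h1.1 hτ.le
  nlinarith [h.1, mul_nonneg hτ.le (speed_nonneg x v)]

/-- The Fermat norm is the larger root in `τ` of `βτ² − 2⟨δ,v⟩τ − |v|² = 0`; beyond it the vector is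
future timelike. -/
lemma isFutureVector_of_fermat_lt {x : S} {v : E} {τ : ℝ} (hβ : 0 < β x)
    (h : fermat δ β x v < τ) : IsFutureVector δ β x v τ := by
  set d := shift δ x v
  set g := speed x v
  have h1 : √(g ^ 2 / β x + (d / β x) ^ 2) < τ - d / β x := by
    have : d / β x + √(g ^ 2 / β x + (d / β x) ^ 2) < τ := h
    linarith
  have h2 : 0 < τ - d / β x := (Real.sqrt_nonneg _).trans_lt h1
  have h3 := (Real.sqrt_lt' h2).1 h1
  have hd : d / β x * β x = d := div_mul_cancel₀ _ hβ.ne'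
  have hg : g ^ 2 / β x * β x = g ^ 2 := div_mul_cancel₀ _ hβ.ne'
  refine ⟨?_, ?_⟩
  · change g ^ 2 + 2 * d * τ < β x * τ ^ 2
    have := mul_lt_mul_of_pos_right h3 hβ
    nlinarith
  · change d < β x * τ
    nlinarith [mul_pos h2 hβ]

lemma fermat_nonneg (hβ : ∀ x, 0 < β x) (x : S) (v : E) : 0 ≤ fermat δ β x v := by
  have h : |shift δ x v / β x| ≤ √(speed x v ^ 2 / β x + (shift δ x v / β x) ^ 2) := by
    refine Real.abs_le_sqrt ?_
    have := div_nonneg (sq_nonneg (speed x v)) (hβ x).le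
    linarith
  have := (abs_le.1 h).1
  unfold fermat
  linarith

lemma fermat_le {x : S} (hβ : 0 < β x) (v : E) :
    fermat δ β x v ≤ (2 * (‖δ x‖ / β x) + 1 / β x + 1) * speed x v := by
  have hg := speed_nonneg x v
  have h0 : |shift δ x v / β x| ≤ ‖δ x‖ / β x * speed x v := by
    rw [abs_div, abs_of_pos hβ, div_mul_eq_mul_div]
    exact div_le_div_of_nonneg_right (abs_shift_le x v) hβ.le
  have h1 : √(speed x v ^ 2 / β x + (shift δ x v / β x) ^ 2)
      ≤ (1 / β x + 1) * speed x v + ‖δ x‖ / β x * speed x v := by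
    have hb : 0 < 1 / β x := by positivity
    have hD : 0 ≤ ‖δ x‖ / β x := by positivity
    refine Real.sqrt_le_iff.2 ⟨by positivity, ?_⟩
    have h2 : (shift δ x v / β x) ^ 2 ≤ (‖δ x‖ / β x * speed x v) ^ 2 := by
      rw [← sq_abs (shift δ x v / β x)]
      exact pow_le_pow_left₀ (abs_nonneg _) h0 2
    have h3 : speed x v ^ 2 / β x ≤ ((1 / β x + 1) * speed x v) ^ 2 := by
      rw [mul_pow, div_eq_mul_one_div, mul_comm]
      exact mul_le_mul_of_nonneg_right (by nlinarith) (sq_nonneg _)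
    have h4 : 0 ≤ (1 / β x + 1) * speed x v * (‖δ x‖ / β x * speed x v) := by positivity
    nlinarith
  have h5 := (abs_le.1 h0).2
  unfold fermat
  linarith

variable [IsManifold 𝓘(ℝ, E) 1 S]
  [IsContinuousRiemannianBundle E (fun x : S ↦ TangentSpace 𝓘(ℝ, E) x)]

lemma continuous_norm_section
    (hδ : Continuous (fun x ↦ (⟨x, δ x⟩ : TangentBundle 𝓘(ℝ, E) S))) :
    Continuous (fun x ↦ ‖δ x‖) := by
  have h := (Continuous.inner_bundle (F := E) (E := fun x : S ↦ TangentSpace 𝓘(ℝ, E) x)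
    (b := id) (v := δ) (w := δ) hδ hδ).sqrt
  refine h.congr fun x ↦ ?_
  rw [norm_eq_sqrt_real_inner]

/-- Near each point, the Fermat metric is controlled by the Riemannian norm, and the Riemannian
norm of the spatial part of a future-directed timelike vector by its time part. -/
lemma exists_nhds_fermat_bounds
    (hδ : Continuous (fun x ↦ (⟨x, δ x⟩ : TangentBundle 𝓘(ℝ, E) S)))
    (hβ : Continuous β) (hβ_pos : ∀ x, 0 < β x) (y : S) :
    ∃ C > 0, ∀ᶠ x in 𝓝 y, ∀ v : E, fermat δ β x v ≤ C * speed x v ∧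
      ∀ τ, IsFutureVector δ β x v τ → speed x v ≤ C * τ := by
  have hN := continuous_norm_section hδ
  have h1 : Continuous fun x ↦ (2 * (‖δ x‖ / β x) + 1 / β x + 1) + (2 * ‖δ x‖ + β x + 1) := by
    have := fun x ↦ (hβ_pos x).ne'
    fun_prop (disch := assumption)
  -- Adding the two nonnegative local constants lets a single `C` serve both estimates.
  set f := fun x ↦ (2 * (‖δ x‖ / β x) + 1 / β x + 1) + (2 * ‖δ x‖ + β x + 1) with hf
  have hpos : ∀ x, 0 ≤ 2 * (‖δ x‖ / β x) + 1 / β x + 1 ∧ 0 ≤ 2 * ‖δ x‖ + β x + 1 := fun x ↦ by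
    have := hβ_pos x
    constructor <;> positivity
  refine ⟨f y + 1, by have := hpos y; simp only [hf]; linarith, ?_⟩
  filter_upwards [h1.continuousAt.eventually_lt_const (lt_add_one (f y))] with x hx v
  have hx' : f x < f y + 1 := hx
  have h2 := hpos x
  refine ⟨(fermat_le (hβ_pos x) v).trans ?_, fun τ h ↦ (h.speed_le (hβ_pos x)).trans ?_⟩
  · refine mul_le_mul_of_nonneg_right ?_ (speed_nonneg x v)
    simp only [hf] at hx' ⊢
    linarith
  · refine mul_le_mul_of_nonneg_right ?_ (h.pos (hβ_pos x)).le
    simp only [hf] at hx' ⊢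
    linarith

lemma continuousOn_speed {x : ℝ → S} {a b : ℝ} (hab : a < b)
    (hx : ContMDiffOn 𝓘(ℝ, ℝ) 𝓘(ℝ, E) 1 x (Icc a b)) :
    ContinuousOn (fun s ↦ speed (x s) (curveVelocity (E := E) x a b s)) (Icc a b) := by
  have hv := continuousOn_curveVelocity hab hx
  have h := ContinuousOn.inner_bundle (F := E) (E := fun x : S ↦ TangentSpace 𝓘(ℝ, E) x)
    (b := x) (v := curveVelocity x a b) (w := curveVelocity x a b) hv hv
  refine h.sqrt.congr fun s _ ↦ ?_
  rw [← Real.sqrt_sq (speed_nonneg (x s) (curveVelocity x a b s)), speed_sq]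

lemma continuousOn_shift (hδ : Continuous (fun x ↦ (⟨x, δ x⟩ : TangentBundle 𝓘(ℝ, E) S)))
    {x : ℝ → S} {a b : ℝ} (hab : a < b)
    (hx : ContMDiffOn 𝓘(ℝ, ℝ) 𝓘(ℝ, E) 1 x (Icc a b)) :
    ContinuousOn (fun s ↦ shift δ (x s) (curveVelocity (E := E) x a b s)) (Icc a b) :=
  ContinuousOn.inner_bundle (F := E) (E := fun x : S ↦ TangentSpace 𝓘(ℝ, E) x)
    (b := x) (v := fun s ↦ δ (x s)) (w := curveVelocity x a b)
    (hδ.comp_continuousOn hx.continuousOn) (continuousOn_curveVelocity hab hx)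

lemma continuousOn_fermat (hδ : Continuous (fun x ↦ (⟨x, δ x⟩ : TangentBundle 𝓘(ℝ, E) S)))
    (hβ : Continuous β) (hβ_pos : ∀ x, 0 < β x) {x : ℝ → S} {a b : ℝ} (hab : a < b)
    (hx : ContMDiffOn 𝓘(ℝ, ℝ) 𝓘(ℝ, E) 1 x (Icc a b)) :
    ContinuousOn (fun s ↦ fermat δ β (x s) (curveVelocity (E := E) x a b s)) (Icc a b) := by
  have h1 := continuousOn_speed hab hx
  have h2 := continuousOn_shift hδ hab hx
  have h3 : ContinuousOn (fun s ↦ β (x s)) (Icc a b) := hβ.comp_continuousOn hx.continuousOn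
  have h4 := h2.div h3 fun s _ ↦ (hβ_pos (x s)).ne'
  exact h4.add (((h1.pow 2).div h3 fun s _ ↦ (hβ_pos (x s)).ne').add (h4.pow 2)).sqrt

end Vectors

/-! ### Future timelike curves, reachability and forward balls. -/

section FutureCurves

variable {E : Type*} [NormedAddCommGroup E] [NormedSpace ℝ E]
  {S : Type*} [TopologicalSpace S] [ChartedSpace E S]
  [RiemannianBundle (fun x : S ↦ TangentSpace 𝓘(ℝ, E) x)]

/-- `(x, t)` is `C¹` on `[a, b]` and its velocities are future-directed timelike. -/
structure IsFuturePiece (δ : (x : S) → TangentSpace 𝓘(ℝ, E) x) (β : S → ℝ) (x : ℝ → S)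
    (t : ℝ → ℝ) (a b : ℝ) : Prop where
  lt : a < b
  space : ContMDiffOn 𝓘(ℝ, ℝ) 𝓘(ℝ, E) 1 x (Icc a b)
  time : ContDiffOn ℝ 1 t (Icc a b)
  future : ∀ s ∈ Icc a b,
    IsFutureVector δ β (x s) (curveVelocity (E := E) x a b s) (derivWithin t (Icc a b) s)

/-- `(x, t)` is piecewise `C¹` on `[a, b]` and future-directed timelike. -/
inductive IsFutureCurve (δ : (x : S) → TangentSpace 𝓘(ℝ, E) x) (β : S → ℝ) (x : ℝ → S)
    (t : ℝ → ℝ) : ℝ → ℝ → Prop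
  | piece {a b : ℝ} (h : IsFuturePiece δ β x t a b) : IsFutureCurve δ β x t a b
  | trans {a b c : ℝ} (h : IsFutureCurve δ β x t a b) (h' : IsFutureCurve δ β x t b c) :
      IsFutureCurve δ β x t a c

variable {δ : (x : S) → TangentSpace 𝓘(ℝ, E) x} {β : S → ℝ}

namespace IsFuturePiece

variable {x x' : ℝ → S} {t t' : ℝ → ℝ} {a b c d : ℝ}

lemma mono (h : IsFuturePiece δ β x t a b) (hac : a ≤ c) (hcd : c < d) (hdb : d ≤ b) :
    IsFuturePiece δ β x t c d := by
  have hsub : Icc c d ⊆ Icc a b := Icc_subset_Icc hac hdb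
  refine ⟨hcd, h.space.mono hsub, h.time.mono hsub, fun s hs ↦ ?_⟩
  rw [curveVelocity_mono hac hcd hdb hs h.space,
    derivWithin_subset hsub (uniqueDiffOn_Icc hcd s hs) (h.time.differentiableOn one_ne_zero s
      (hsub hs))]
  exact h.future s (hsub hs)

lemma congr (h : IsFuturePiece δ β x t a b) (hx : EqOn x' x (Icc a b))
    (ht : EqOn t' t (Icc a b)) : IsFuturePiece δ β x' t' a b := by
  refine ⟨h.lt, h.space.congr hx, h.time.congr ht, fun s hs ↦ ?_⟩
  rw [curveVelocity_congr hx hs, derivWithin_congr ht (ht hs), hx hs]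
  exact h.future s hs

/-- The cone is stable under positive scaling and does not depend on `t`, so increasing affine
reparametrizations and time translations preserve it. -/
lemma comp_affine (h : IsFuturePiece δ β x t c d) {k : ℝ} (hk : 0 < k) (m r : ℝ)
    (ha : k * a + m = c) (hb : k * b + m = d) :
    IsFuturePiece δ β (fun s ↦ x (k * s + m)) (fun s ↦ t (k * s + m) + r) a b := by
  have hab : a < b := by
    have := h.lt
    rw [← ha, ← hb] at this
    exact lt_of_mul_lt_mul_left (by linarith) hk.le
  have hmaps : MapsTo (fun s ↦ k * s + m) (Icc a b) (Icc c d) := fun s hs ↦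
    ⟨by rw [← ha]; simpa using mul_le_mul_of_nonneg_left hs.1 hk.le,
     by rw [← hb]; simpa using mul_le_mul_of_nonneg_left hs.2 hk.le⟩
  refine ⟨hab, contMDiffOn_comp_affine k m hmaps h.space, ?_, fun s hs ↦ ?_⟩
  · exact (h.time.comp (by fun_prop) hmaps).add contDiffOn_const
  · have hd : derivWithin (fun s ↦ t (k * s + m) + r) (Icc a b) s
        = k * derivWithin t (Icc c d) (k * s + m) := by
      have h1 : HasDerivWithinAt (fun s : ℝ ↦ k * s + m) k (Icc a b) s := by
        simpa using (((hasDerivAt_id s).const_mul k).add_const m).hasDerivWithinAt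
      have h2 := (h.time.differentiableOn one_ne_zero _ (hmaps hs)).hasDerivWithinAt
      have h3 := (h2.comp s h1 hmaps).add_const r
      rw [mul_comm]
      exact h3.derivWithin (uniqueDiffOn_Icc hab s hs)
    rw [curveVelocity_comp_affine k m hab hmaps hs h.space, hd]
    exact (h.future _ (hmaps hs)).smul hk

lemma time_lt (h : IsFuturePiece δ β x t a b) (hβ : ∀ x, 0 < β x) : t a < t b := by
  refine strictMonoOn_of_deriv_pos (convex_Icc a b) h.time.continuousOn (fun s hs ↦ ?_)
    (left_mem_Icc.2 h.lt.le) (right_mem_Icc.2 h.lt.le) h.lt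
  rw [interior_Icc] at hs
  rw [← derivWithin_of_mem_nhds (Icc_mem_nhds hs.1 hs.2)]
  exact (h.future s (Ioo_subset_Icc_self hs)).pos (hβ _)

end IsFuturePiece

namespace IsFutureCurve

variable {x x' : ℝ → S} {t t' : ℝ → ℝ} {a b c d : ℝ}

lemma lt (h : IsFutureCurve δ β x t a b) : a < b := by
  induction h with
  | piece h => exact h.lt
  | trans _ _ h h' => exact h.trans h'

lemma time_lt (h : IsFutureCurve δ β x t a b) (hβ : ∀ x, 0 < β x) : t a < t b := by
  induction h with
  | piece h => exact h.time_lt hβ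
  | trans _ _ h h' => exact h.trans h'

lemma mono (h : IsFutureCurve δ β x t a b) (hac : a ≤ c) (hcd : c < d) (hdb : d ≤ b) :
    IsFutureCurve δ β x t c d := by
  induction h generalizing c d with
  | piece h => exact .piece (h.mono hac hcd hdb)
  | @trans a b e _ _ ih ih' =>
    rcases le_or_gt d b with hd | hd
    · exact ih hac hcd hd
    rcases le_or_gt b c with hc | hc
    · exact ih' hc hcd hdb
    exact (ih hac hc le_rfl).trans (ih' le_rfl hd hdb)

lemma congr (h : IsFutureCurve δ β x t a b) (hx : EqOn x' x (Icc a b))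
    (ht : EqOn t' t (Icc a b)) : IsFutureCurve δ β x' t' a b := by
  induction h with
  | piece h => exact .piece (h.congr hx ht)
  | @trans a b c h h' ih ih' =>
    have h1 : Icc a b ⊆ Icc a c := Icc_subset_Icc_right h'.lt.le
    have h2 : Icc b c ⊆ Icc a c := Icc_subset_Icc_left h.lt.le
    exact (ih (hx.mono h1) (ht.mono h1)).trans (ih' (hx.mono h2) (ht.mono h2))

lemma comp_affine (h : IsFutureCurve δ β x t c d) {k : ℝ} (hk : 0 < k) (m r : ℝ)
    (ha : k * a + m = c) (hb : k * b + m = d) :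
    IsFutureCurve δ β (fun s ↦ x (k * s + m)) (fun s ↦ t (k * s + m) + r) a b := by
  induction h generalizing a b with
  | piece h => exact .piece (h.comp_affine hk m r ha hb)
  | @trans c e d _ _ ih ih' =>
    have he : k * ((e - m) / k) + m = e := by field_simp; ring
    exact (ih ha he).trans (ih' he hb)

lemma glue (h : IsFutureCurve δ β x t a b) (h' : IsFutureCurve δ β x' t' b c)
    (hx : x b = x' b) (ht : t b = t' b) :
    IsFutureCurve δ β (fun s ↦ if s ≤ b then x s else x' s)
      (fun s ↦ if s ≤ b then t s else t' s) a c := by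
  refine (h.congr (fun s hs ↦ if_pos hs.2) (fun s hs ↦ if_pos hs.2)).trans (h'.congr ?_ ?_)
  · intro s hs
    rcases hs.1.eq_or_lt with rfl | hs
    · simp [hx]
    · simp [hs.not_ge]
  · intro s hs
    rcases hs.1.eq_or_lt with rfl | hs
    · simp [ht]
    · simp [hs.not_ge]

lemma continuousOn_time (h : IsFutureCurve δ β x t a b) : ContinuousOn t (Icc a b) := by
  induction h with
  | piece h => exact h.time.continuousOn
  | trans h h' ih ih' =>
    rw [← Icc_union_Icc_eq_Icc h.lt.le h'.lt.le]
    exact ih.union_of_isClosed ih' isClosed_Icc isClosed_Icc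

lemma isPiecewiseInCone (h : IsFutureCurve δ β x t a b) :
    IsPiecewiseInCone (futureCone δ β) (fun s ↦ (x s, t s)) a b := by
  induction h with
  | trans _ _ h h' => exact h.trans h'
  | @piece a b h =>
    refine ⟨1, fun i ↦ a + i * (b - a), strictMono_nat_of_lt_succ fun i ↦ ?_, by simp, by simp,
      fun i hi ↦ ?_⟩
    · push_cast
      linarith [h.lt]
    · obtain rfl : i = 0 := by omega
      have hab : (a + ((0 : ℕ) : ℝ) * (b - a)) = a ∧ (a + ((0 + 1 : ℕ) : ℝ) * (b - a)) = b := by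
        simp
      simp only [hab.1, hab.2]
      refine ⟨h.space.prodMk (contMDiffOn_iff_contDiffOn.2 h.time), fun s hs ↦ ?_⟩
      rw [velocity_prodMk h.lt hs h.space h.time]
      exact (mem_futureCone_iff (x s, t s) _ _).2 (h.future s hs)

end IsFutureCurve

/-- The point `(y, τ)` can be reached from `(x, 0)` by a future-directed timelike curve. -/
def Reach (δ : (x : S) → TangentSpace 𝓘(ℝ, E) x) (β : S → ℝ) (x y : S) (τ : ℝ) : Prop :=
  ∃ (X : ℝ → S) (T : ℝ → ℝ), IsFutureCurve δ β X T 0 1 ∧ X 0 = x ∧ X 1 = y ∧ T 0 = 0 ∧ T 1 = τ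

lemma IsFutureCurve.reach {x : ℝ → S} {t : ℝ → ℝ} {a b : ℝ} (h : IsFutureCurve δ β x t a b) :
    Reach δ β (x a) (x b) (t b - t a) :=
  ⟨_, _, h.comp_affine (sub_pos.2 h.lt) a (-t a) (by ring) (by ring), by simp, by simp, by simp,
    by simp [sub_eq_add_neg]⟩

/-- Translate the second curve in time so that it starts where the first one ends. -/
lemma Reach.trans {x y z : S} {τ σ : ℝ} (h : Reach δ β x y τ) (h' : Reach δ β y z σ) :
    Reach δ β x z (τ + σ) := by
  obtain ⟨X, T, hc, hX0, hX1, hT0, hT1⟩ := h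
  obtain ⟨X', T', hc', hX0', hX1', hT0', hT1'⟩ := h'
  have h2 := hc'.comp_affine (a := 1) (b := 2) one_pos (-1) τ (by norm_num) (by norm_num)
  have := (hc.glue h2 (by simp [hX1, hX0']) (by simp [hT1, hT0'])).reach
  have h1 : (-1 : ℝ) + 2 = 1 := by norm_num
  have h2 : ¬ (2 : ℝ) ≤ 1 := by norm_num
  simpa [h1, h2, hX0, hX1', hT0, hT1', add_comm] using this

lemma Reach.pos {x y : S} {τ : ℝ} (h : Reach δ β x y τ) (hβ : ∀ x, 0 < β x) : 0 < τ := by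
  obtain ⟨X, T, hc, -, -, hT0, hT1⟩ := h
  simpa [hT0, hT1] using hc.time_lt hβ

/-- The point `(w, τ)` can be reached from `(x, 0)` for some `τ < r`. -/
def forwardBall (δ : (x : S) → TangentSpace 𝓘(ℝ, E) x) (β : S → ℝ) (x : S) (r : ℝ) : Set S :=
  {w | ∃ τ < r, Reach δ β x w τ}

lemma forwardBall_mono {x : S} {r r' : ℝ} (h : r ≤ r') :
    forwardBall δ β x r ⊆ forwardBall δ β x r' :=
  fun _ ⟨τ, hτ, hw⟩ ↦ ⟨τ, hτ.trans_le h, hw⟩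

lemma mem_forwardBall_trans {x y z : S} {r r' : ℝ} (h : y ∈ forwardBall δ β x r)
    (h' : z ∈ forwardBall δ β y r') : z ∈ forwardBall δ β x (r + r') := by
  obtain ⟨τ, hτ, h⟩ := h
  obtain ⟨τ', hτ', h'⟩ := h'
  exact ⟨τ + τ', add_lt_add hτ hτ', h.trans h'⟩

/-- Cut the curve at the instant when half of the total time has elapsed. -/
lemma exists_mem_forwardBall_half (hβ : ∀ x, 0 < β x) {x w : S} {r : ℝ}
    (h : w ∈ forwardBall δ β x r) :
    ∃ y ∈ forwardBall δ β x (r / 2), w ∈ forwardBall δ β y (r / 2) := by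
  obtain ⟨τ, hτ, hr⟩ := h
  have hτ0 := hr.pos hβ
  obtain ⟨X, T, hc, rfl, rfl, hT0, hT1⟩ := hr
  obtain ⟨s, hs, hTs⟩ := intermediate_value_Icc zero_le_one hc.continuousOn_time
    (show τ / 2 ∈ Icc (T 0) (T 1) by rw [hT0, hT1]; constructor <;> linarith)
  have hs0 : 0 < s := lt_of_le_of_ne hs.1 (by rintro rfl; linarith)
  have hs1 : s < 1 := lt_of_le_of_ne hs.2 (by rintro rfl; linarith)
  exact ⟨X s, ⟨_, by linarith, (hc.mono le_rfl hs0 hs.2).reach⟩,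
    ⟨_, by linarith, (hc.mono hs.1 hs1 le_rfl).reach⟩⟩

/-- Successive future-directed timelike curves, preceded by a vertical half-line, form a timelike
curve defined on the whole line. -/
lemma exists_isFutureCurve_of_reach (hβ : ∀ x, 0 < β x) {y : ℕ → S} {τ : ℕ → ℝ}
    (h : ∀ k, Reach δ β (y k) (y (k + 1)) (τ k)) :
    ∃ (X : ℝ → S) (T : ℝ → ℝ), (∀ k : ℕ, X k = y k) ∧
      (∀ k : ℕ, T k = ∑ j ∈ Finset.range k, τ j) ∧ (∀ s ≤ 0, T s = s) ∧
      ∀ a b, a < b → IsFutureCurve δ β X T a b := by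
  choose U V hUV hU0 hU1 hV0 hV1 using h
  set X : ℝ → S := fun s ↦ if s ≤ 0 then y 0 else U ⌊s⌋₊ (s - ⌊s⌋₊) with hX
  set T : ℝ → ℝ := fun s ↦ if s ≤ 0 then s else
    V ⌊s⌋₊ (s - ⌊s⌋₊) + ∑ j ∈ Finset.range ⌊s⌋₊, τ j with hT
  -- The formula is needed on the closed interval, although the floor jumps at its right end and `s
  -- = 0` falls in the vertical branch; the matching end points of successive pieces make it true
  -- there.
  have hpiece : ∀ k : ℕ, ∀ s ∈ Icc (k : ℝ) (k + 1), X s = U k (s - k) ∧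
      T s = V k (s - k) + ∑ j ∈ Finset.range k, τ j := by
    intro k s hs
    rcases le_or_gt s 0 with h0 | h0
    · have hs0 : s = 0 := le_antisymm h0 ((Nat.cast_nonneg k).trans hs.1)
      have hk : k = 0 := by
        have : (k : ℝ) ≤ 0 := hs0 ▸ hs.1
        exact Nat.le_zero.1 (by exact_mod_cast this)
      subst hk
      simp [hX, hT, hs0, hU0, hV0]
    · rcases hs.2.eq_or_lt with h1 | h1
      · have hf : ⌊s⌋₊ = k + 1 := by
          rw [h1]
          exact_mod_cast Nat.floor_natCast (R := ℝ) (k + 1)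
        have e1 : s - ((k + 1 : ℕ) : ℝ) = 0 := by rw [h1]; push_cast; ring
        have e2 : s - (k : ℝ) = 1 := by rw [h1]; ring
        simp only [hX, hT, h0.not_ge, if_false, hf, e1, e2, hU0, hU1, hV0, hV1,
          Finset.sum_range_succ, true_and]
        ring
      · have hf : ⌊s⌋₊ = k := (Nat.floor_eq_iff h0.le).2 ⟨hs.1, h1⟩
        simp only [hX, hT, h0.not_ge, if_false, hf, true_and]
  have hnat : ∀ k : ℕ, X k = y k ∧ T k = ∑ j ∈ Finset.range k, τ j := fun k ↦ by
    have := hpiece k k ⟨le_rfl, by linarith⟩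
    simpa [hU0, hV0] using this
  have hfwd : ∀ n : ℕ, IsFutureCurve δ β X T 0 (n + 1) := by
    have hstep : ∀ k : ℕ, IsFutureCurve δ β X T k (k + 1) := fun k ↦ by
      refine ((hUV k).comp_affine (a := k) (b := k + 1) one_pos (-k)
        (∑ j ∈ Finset.range k, τ j) (by ring) (by ring)).congr (fun s hs ↦ ?_) (fun s hs ↦ ?_)
      · simpa [sub_eq_add_neg] using (hpiece k s hs).1
      · simpa [sub_eq_add_neg] using (hpiece k s hs).2
    intro n
    induction n with
    | zero => simpa using hstep 0
    | succ n ih => exact ih.trans (by simpa using hstep (n + 1))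
  have hbwd : ∀ r : ℝ, r < 0 → IsFutureCurve δ β X T r 0 := fun r hr ↦ by
    have hp : IsFuturePiece δ β (fun _ ↦ y 0) (fun s ↦ s) r 0 := by
      refine ⟨hr, contMDiffOn_const, contDiffOn_id, fun s hs ↦ ?_⟩
      have h1 : curveVelocity (E := E) (fun _ : ℝ ↦ y 0) r 0 s = 0 := by
        simp only [curveVelocity, mfderivWithin_const]
        rfl
      rw [h1, derivWithin_id' _ _ (uniqueDiffOn_Icc hr s hs)]
      exact isFutureVector_zero (hβ _) one_pos
    exact .piece (hp.congr (fun s hs ↦ if_pos hs.2) (fun s hs ↦ if_pos hs.2))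
  refine ⟨X, T, fun k ↦ (hnat k).1, fun k ↦ (hnat k).2, fun s hs ↦ if_pos hs, fun a b hab ↦ ?_⟩
  obtain ⟨n, hn⟩ := exists_nat_ge b
  -- Taking the minimum with `-1` makes the vertical piece nondegenerate even when `a ≥ 0`; the
  -- surplus is then cut off.
  exact ((hbwd (min a (-1)) (by simp)).trans (hfwd n)).mono (min_le_left _ _) hab
    (by linarith)

end FutureCurves

/-! ### Local comparison of forward balls with Riemannian balls. -/

section Reachability

variable {E : Type*} [NormedAddCommGroup E] [NormedSpace ℝ E]
  {S : Type*} [EMetricSpace S] [ChartedSpace E S] [IsManifold 𝓘(ℝ, E) 1 S]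
  [RiemannianBundle (fun x : S ↦ TangentSpace 𝓘(ℝ, E) x)]
  [IsContinuousRiemannianBundle E (fun x : S ↦ TangentSpace 𝓘(ℝ, E) x)]
  {δ : (x : S) → TangentSpace 𝓘(ℝ, E) x} {β : S → ℝ}

lemma pathELength_eq_ofReal {x : ℝ → S} {a b : ℝ} (hab : a < b)
    (hx : ContMDiffOn 𝓘(ℝ, ℝ) 𝓘(ℝ, E) 1 x (Icc a b)) :
    pathELength 𝓘(ℝ, E) x a b
      = ENNReal.ofReal (∫ s in a..b, speed (x s) (curveVelocity (E := E) x a b s)) := by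
  have hc := continuousOn_speed hab hx
  rw [pathELength_eq_lintegral_mfderivWithin_Icc, intervalIntegral.integral_of_le hab.le,
    ← MeasureTheory.integral_Icc_eq_integral_Ioc,
    MeasureTheory.ofReal_integral_eq_lintegral_ofReal (hc.integrableOn_Icc)
      (Eventually.of_forall fun s ↦ speed_nonneg _ _)]
  refine MeasureTheory.lintegral_congr fun s ↦ ?_
  exact (ofReal_norm (E := TangentSpace 𝓘(ℝ, E) (x s)) _).symm

/-- The end point of a curve of Fermat length less than `r` lies in the forward ball of
radius `r`. -/
lemma mem_forwardBall_of_integral_fermat_lt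
    (hδ : Continuous (fun x ↦ (⟨x, δ x⟩ : TangentBundle 𝓘(ℝ, E) S)))
    (hβ : Continuous β) (hβ_pos : ∀ x, 0 < β x) {x : ℝ → S} {a b r : ℝ} (hab : a < b)
    (hx : ContMDiffOn 𝓘(ℝ, ℝ) 𝓘(ℝ, E) 1 x (Icc a b))
    (hr : ∫ s in a..b, fermat δ β (x s) (curveVelocity (E := E) x a b s) < r) :
    x b ∈ forwardBall δ β (x a) r := by
  set F := fun s ↦ fermat δ β (x s) (curveVelocity (E := E) x a b s) with hF
  have hFc : ContinuousOn F (Icc a b) := continuousOn_fermat hδ hβ hβ_pos hab hx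
  set f := IccExtend hab.le ((Icc a b).domRestrict F) with hf
  have hfc : Continuous f := hFc.domRestrict.Icc_extend'
  have hfF : EqOn f F (Icc a b) := fun s hs ↦
    IccExtend_of_mem hab.le ((Icc a b).domRestrict F) hs
  -- A time function growing `ε` faster than Fermat length makes the curve strictly timelike;
  -- spending half of the slack keeps its duration below `r`.
  obtain ⟨ε, hε, hεr⟩ : ∃ ε > 0, (∫ s in a..b, F s) + ε * (b - a) < r := by
    refine ⟨(r - ∫ s in a..b, F s) / (2 * (b - a)), ?_, ?_⟩
    · exact div_pos (sub_pos.2 hr) (by linarith)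
    · have : b - a ≠ 0 := (sub_pos.2 hab).ne'
      have hr' : (∫ s in a..b, F s) < r := hr
      field_simp
      linarith
  have hgc : Continuous fun s ↦ f s + ε := hfc.add_const ε
  set t := fun s ↦ ∫ u in a..s, (f u + ε) with ht
  have htd : ∀ s, HasDerivAt t (f s + ε) s := fun s ↦ hgc.integral_hasStrictDerivAt a s |>.hasDerivAt
  have htC : ContDiff ℝ 1 t := by
    refine contDiff_one_iff_deriv.2 ⟨fun s ↦ (htd s).differentiableAt, ?_⟩
    rwa [show deriv t = fun s ↦ f s + ε from funext fun s ↦ (htd s).deriv]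
  have hpiece : IsFuturePiece δ β x t a b := by
    refine ⟨hab, hx, htC.contDiffOn, fun s hs ↦ isFutureVector_of_fermat_lt (hβ_pos _) ?_⟩
    rw [(htd s).hasDerivWithinAt.derivWithin (uniqueDiffOn_Icc hab s hs), hfF hs]
    exact lt_add_of_pos_right _ hε
  refine ⟨_, ?_, (IsFutureCurve.piece hpiece).reach⟩
  have h1 : t b = (∫ s in a..b, F s) + ε * (b - a) := by
    simp only [ht]
    rw [intervalIntegral.integral_add (hfc.intervalIntegrable _ _) (by simp)]
    rw [intervalIntegral.integral_congr (g := F) (by rwa [uIcc_of_le hab.le])]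
    simp [mul_comm]
  have h2 : t a = 0 := by simp [ht]
  rw [h1, h2, sub_zero]
  exact hεr

lemma integral_fermat_mono
    (hδ : Continuous (fun x ↦ (⟨x, δ x⟩ : TangentBundle 𝓘(ℝ, E) S)))
    (hβ : Continuous β) (hβ_pos : ∀ x, 0 < β x) {x : ℝ → S} {a b c : ℝ} (hac : a < c)
    (hcb : c ≤ b) (hx : ContMDiffOn 𝓘(ℝ, ℝ) 𝓘(ℝ, E) 1 x (Icc a b)) :
    ∫ s in a..c, fermat δ β (x s) (curveVelocity (E := E) x a c s)
      ≤ ∫ s in a..b, fermat δ β (x s) (curveVelocity (E := E) x a b s) := by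
  have hab := hac.trans_le hcb
  have h1 : ∫ s in a..c, fermat δ β (x s) (curveVelocity (E := E) x a c s)
      = ∫ s in a..c, fermat δ β (x s) (curveVelocity (E := E) x a b s) := by
    refine intervalIntegral.integral_congr fun s hs ↦ ?_
    rw [uIcc_of_le hac.le] at hs
    simp only [curveVelocity_mono le_rfl hac hcb hs hx]
  rw [h1]
  refine intervalIntegral.integral_mono_interval le_rfl hac.le hcb
    (Eventually.of_forall fun s ↦ fermat_nonneg hβ_pos _ _) ?_
  exact (continuousOn_fermat hδ hβ hβ_pos hab hx).intervalIntegrable_of_Icc hab.le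

variable [IsRiemannianManifold 𝓘(ℝ, E) S]

lemma edist_le_ofReal_integral_speed {x : ℝ → S} {a b : ℝ} (hab : a < b)
    (hx : ContMDiffOn 𝓘(ℝ, ℝ) 𝓘(ℝ, E) 1 x (Icc a b)) :
    edist (x a) (x b)
      ≤ ENNReal.ofReal (∫ s in a..b, speed (x s) (curveVelocity (E := E) x a b s)) := by
  rw [← pathELength_eq_ofReal hab hx, IsRiemannianManifold.out (I := 𝓘(ℝ, E)) (x a) (x b)]
  exact riemannianEDist_le_pathELength hx rfl rfl hab.le

lemma edist_le_of_speed_le {x : ℝ → S} {t : ℝ → ℝ} {a b C : ℝ} (hab : a < b)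
    (hx : ContMDiffOn 𝓘(ℝ, ℝ) 𝓘(ℝ, E) 1 x (Icc a b)) (ht : ContDiffOn ℝ 1 t (Icc a b))
    (h : ∀ s ∈ Ioo a b,
      speed (x s) (curveVelocity (E := E) x a b s) ≤ C * derivWithin t (Icc a b) s) :
    edist (x a) (x b) ≤ ENNReal.ofReal (C * (t b - t a)) := by
  refine (edist_le_ofReal_integral_speed hab hx).trans (ENNReal.ofReal_le_ofReal ?_)
  have hc : ContinuousOn (derivWithin t (Icc a b)) (Icc a b) :=
    ht.continuousOn_derivWithin (uniqueDiffOn_Icc hab) le_rfl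
  have hI : IntervalIntegrable (derivWithin t (Icc a b)) MeasureTheory.volume a b :=
    hc.intervalIntegrable_of_Icc hab.le
  have h1 : ∫ s in a..b, derivWithin t (Icc a b) s = t b - t a := by
    refine intervalIntegral.integral_eq_sub_of_hasDerivAt_of_le hab.le ht.continuousOn
      (fun s hs ↦ ?_) hI
    exact ((ht.differentiableOn one_ne_zero s (Ioo_subset_Icc_self hs)).hasDerivWithinAt).hasDerivAt
      (Icc_mem_nhds hs.1 hs.2)
  rw [← h1, ← intervalIntegral.integral_const_mul]
  exact intervalIntegral.integral_mono_on_of_le_Ioo hab.le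
    ((continuousOn_speed hab hx).intervalIntegrable_of_Icc hab.le) (hI.const_mul C) h

/-- Points near `y` can be reached from each other in a short time. -/
lemma exists_nhds_mem_forwardBall
    (hδ : Continuous (fun x ↦ (⟨x, δ x⟩ : TangentBundle 𝓘(ℝ, E) S)))
    (hβ : Continuous β) (hβ_pos : ∀ x, 0 < β x) (y : S) {ε : ℝ} (hε : 0 < ε) :
    ∃ U ∈ 𝓝 y, ∀ u ∈ U, ∀ w ∈ U, w ∈ forwardBall δ β u ε := by
  obtain ⟨C, hC, hU⟩ := exists_nhds_fermat_bounds (E := E) hδ hβ hβ_pos y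
  obtain ⟨ρ, hρ, hball⟩ := EMetric.mem_nhds_iff.1 hU
  -- A path of length below `2η` between points of the `η`-ball stays in the `3η`-ball, where the
  -- Fermat bound holds, so its Fermat length is below `2Cη`.
  obtain ⟨η, hη, hη1, hη2⟩ : ∃ η : ℝ, 0 < η ∧ ENNReal.ofReal (3 * η) ≤ ρ ∧ C * (2 * η) < ε := by
    obtain ⟨r, hr0, hr⟩ := ENNReal.lt_iff_exists_real_btwn.1 hρ
    have hr1 : 0 < r := by simpa using hr.1
    refine ⟨min (r / 3) (ε / (4 * C)), by positivity, ?_, ?_⟩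
    · refine (ENNReal.ofReal_le_ofReal ?_).trans hr.2.le
      linarith [min_le_left (r / 3) (ε / (4 * C))]
    · have := mul_le_mul_of_nonneg_left (min_le_right (r / 3) (ε / (4 * C))) hC.le
      have h2 : C * (ε / (4 * C)) = ε / 4 := by field_simp
      linarith
  refine ⟨Metric.eball y (ENNReal.ofReal η), Metric.eball_mem_nhds y (by simpa using hη),
    fun u hu w hw ↦ ?_⟩
  have huw : edist u w < ENNReal.ofReal (2 * η) := by
    calc edist u w ≤ edist u y + edist w y := edist_triangle_right u w y
      _ < ENNReal.ofReal η + ENNReal.ofReal η := ENNReal.add_lt_add hu hw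
      _ = ENNReal.ofReal (2 * η) := by rw [← ENNReal.ofReal_add hη.le hη.le, two_mul]
  rw [IsRiemannianManifold.out (I := 𝓘(ℝ, E)) u w] at huw
  obtain ⟨γ, rfl, rfl, hγ, hlen⟩ := exists_lt_of_riemannianEDist_lt huw
  have hnear : ∀ s ∈ Icc (0 : ℝ) 1, γ s ∈ Metric.eball y ρ := fun s hs ↦ by
    have h1 : edist (γ s) (γ 0) < ENNReal.ofReal (2 * η) := by
      rw [edist_comm, IsRiemannianManifold.out (I := 𝓘(ℝ, E)) (γ 0) (γ s)]
      refine lt_of_le_of_lt ?_ hlen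
      exact (riemannianEDist_le_pathELength (hγ.mono (Icc_subset_Icc_right hs.2)) rfl rfl
        hs.1).trans (pathELength_mono le_rfl hs.2)
    calc edist (γ s) y ≤ edist (γ s) (γ 0) + edist (γ 0) y := edist_triangle _ _ _
      _ < ENNReal.ofReal (2 * η) + ENNReal.ofReal η := ENNReal.add_lt_add h1 hu
      _ = ENNReal.ofReal (3 * η) := by
        rw [← ENNReal.ofReal_add (by linarith) hη.le]; congr 1; ring
      _ ≤ ρ := hη1
  refine mem_forwardBall_of_integral_fermat_lt hδ hβ hβ_pos one_pos hγ (lt_of_le_of_lt ?_ hη2)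
  rw [pathELength_eq_ofReal one_pos hγ, ENNReal.ofReal_lt_ofReal_iff (by linarith)] at hlen
  refine le_trans ?_ (mul_le_mul_of_nonneg_left hlen.le hC.le)
  rw [← intervalIntegral.integral_const_mul]
  exact intervalIntegral.integral_mono_on zero_le_one
    ((continuousOn_fermat hδ hβ hβ_pos one_pos hγ).intervalIntegrable_of_Icc zero_le_one)
    (((continuousOn_speed one_pos hγ).intervalIntegrable_of_Icc zero_le_one).const_mul C)
    fun s hs ↦ (hball (hnear s hs) _).1

/-- A continuity argument: while the curve is inside the `ρ`-ball its length is at most `C` times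
the elapsed time, which is too short for it to get out. -/
lemma IsFutureCurve.edist_le {y : S} {C ρ : ℝ} (hβ_pos : ∀ x, 0 < β x) (hC : 0 ≤ C)
    (hball : ∀ x ∈ Metric.eball y (ENNReal.ofReal ρ), ∀ (v : E) (τ : ℝ),
      IsFutureVector δ β x v τ → speed x v ≤ C * τ)
    {x : ℝ → S} {t : ℝ → ℝ} {a b : ℝ} (h : IsFutureCurve δ β x t a b) {A : ℝ} (hA : 0 ≤ A)
    (ha : edist (x a) y ≤ ENNReal.ofReal A) (hAρ : A + C * (t b - t a) < ρ) :
    edist (x b) y ≤ ENNReal.ofReal (A + C * (t b - t a)) := by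
  induction h generalizing A with
  | @trans a b c h h' ih ih' =>
    have h1 := mul_nonneg hC (sub_pos.2 (h.time_lt hβ_pos)).le
    have h2 := mul_nonneg hC (sub_pos.2 (h'.time_lt hβ_pos)).le
    have := ih' (by linarith) (ih hA ha (by linarith)) (by linarith)
    convert this using 2
    ring
  | @piece a b h =>
    -- Only interior points are required to lie in the ball, so that the estimate applies at a first
    -- exit time.
    have hest : ∀ s, a < s → s ≤ b → (∀ u ∈ Ioo a s, x u ∈ Metric.eball y (ENNReal.ofReal ρ)) →
        edist (x s) y ≤ ENNReal.ofReal (A + C * (t b - t a)) := by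
      intro s has hsb hu
      have hp := h.mono le_rfl has hsb
      have hst : t s ≤ t b := by
        rcases hsb.eq_or_lt with rfl | hsb
        · exact le_rfl
        · exact ((h.mono has.le hsb le_rfl).time_lt hβ_pos).le
      have h1 := edist_le_of_speed_le (C := C) has hp.space hp.time fun u hu' ↦
        hball _ (hu u hu') _ _ (hp.future u (Ioo_subset_Icc_self hu'))
      calc edist (x s) y ≤ edist (x s) (x a) + edist (x a) y := edist_triangle _ _ _
        _ ≤ ENNReal.ofReal (C * (t s - t a)) + ENNReal.ofReal A := by
          rw [edist_comm (x s)]; exact add_le_add h1 ha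
        _ = ENNReal.ofReal (C * (t s - t a) + A) :=
          (ENNReal.ofReal_add (mul_nonneg hC (sub_pos.2 (hp.time_lt hβ_pos)).le) hA).symm
        _ ≤ _ := ENNReal.ofReal_le_ofReal (by
          linarith [mul_le_mul_of_nonneg_left (sub_le_sub_right hst (t a)) hC])
    have hρ : ENNReal.ofReal (A + C * (t b - t a)) < ENNReal.ofReal ρ := by
      have := mul_nonneg hC (sub_pos.2 (h.time_lt hβ_pos)).le
      exact (ENNReal.ofReal_lt_ofReal_iff (by linarith)).2 hAρ
    refine hest b h.lt le_rfl ?_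
    by_contra! hne
    obtain ⟨u, hu, hxu⟩ := hne
    have hclosed : IsClosed (Icc a b ∩ {s | ENNReal.ofReal ρ ≤ edist (x s) y}) :=
      (continuous_edist.comp_continuousOn
        (h.space.continuousOn.prodMk (continuousOn_const (c := y)))).preimage_isClosed_of_isClosed isClosed_Icc
        isClosed_Ici
    obtain ⟨s, ⟨hs, hs'⟩, hmin⟩ := (isCompact_Icc.of_isClosed_subset hclosed
      inter_subset_left).exists_isLeast ⟨u, Ioo_subset_Icc_self hu,
        show ENNReal.ofReal ρ ≤ edist (x u) y from le_of_not_gt hxu⟩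
    have has : a < s := by
      refine lt_of_le_of_ne hs.1 ?_
      rintro rfl
      have hAC := mul_nonneg hC (sub_pos.2 (h.time_lt hβ_pos)).le
      exact absurd (hs'.trans ha) (not_le.2 ((ENNReal.ofReal_lt_ofReal_iff (by linarith)).2
        (by linarith)))
    refine absurd (hs'.trans (hest s has hs.2 fun u hu' ↦ ?_)) (not_le.2 hρ)
    by_contra hxu'
    exact absurd (hmin ⟨⟨hu'.1.le, hu'.2.le.trans hs.2⟩,
      show ENNReal.ofReal ρ ≤ edist (x u) y from le_of_not_gt hxu'⟩) (not_le.2 hu'.2)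

/-- Small forward balls are relatively compact. -/
lemma exists_forwardBall_subset_isCompact [FiniteDimensional ℝ E]
    (hδ : Continuous (fun x ↦ (⟨x, δ x⟩ : TangentBundle 𝓘(ℝ, E) S)))
    (hβ : Continuous β) (hβ_pos : ∀ x, 0 < β x) (y : S) :
    ∃ r > 0, ∃ K, IsCompact K ∧ forwardBall δ β y r ⊆ K := by
  have : LocallyCompactSpace S := ChartedSpace.locallyCompactSpace E S
  obtain ⟨C, hC, hU⟩ := exists_nhds_fermat_bounds (E := E) hδ hβ hβ_pos y
  obtain ⟨K, hK, hKy⟩ := exists_compact_mem_nhds y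
  obtain ⟨ρ', hρ', hball⟩ := EMetric.mem_nhds_iff.1 (inter_mem hU hKy)
  obtain ⟨ρ, hρ0, hρ, hρρ'⟩ := ENNReal.lt_iff_exists_real_btwn.1 hρ'
  have hρpos : 0 < ρ := by simpa using hρ
  have hsub : Metric.eball y (ENNReal.ofReal ρ) ⊆ Metric.eball y ρ' :=
    Metric.eball_subset_eball hρρ'.le
  -- In time less than `ρ / C` a timelike curve covers distance less than `ρ`.
  refine ⟨ρ / C, by positivity, K, hK, ?_⟩
  rintro w ⟨τ, hτ, X, T, hXT, rfl, rfl, hT0, rfl⟩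
  have hlt : 0 + C * (T 1 - T 0) < ρ := by
    rw [hT0, sub_zero, zero_add, mul_comm]
    exact (lt_div_iff₀ hC).1 hτ
  have h := hXT.edist_le hβ_pos hC.le (fun x hx v ↦ ((hball (hsub hx)).1 v).2) le_rfl (by simp) hlt
  exact (hball (hsub (h.trans_lt ((ENNReal.ofReal_lt_ofReal_iff hρpos).2 hlt)))).2

end Reachability

/-! ### Relative compactness of forward balls from the Cauchy property. -/

section Completeness

variable {E : Type*} [NormedAddCommGroup E] [NormedSpace ℝ E]
  {S : Type*} [EMetricSpace S] [ChartedSpace E S] [IsManifold 𝓘(ℝ, E) 1 S]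
  [RiemannianBundle (fun x : S ↦ TangentSpace 𝓘(ℝ, E) x)]
  [IsContinuousRiemannianBundle E (fun x : S ↦ TangentSpace 𝓘(ℝ, E) x)]
  [IsRiemannianManifold 𝓘(ℝ, E) S]
  {δ : (x : S) → TangentSpace 𝓘(ℝ, E) x} {β : S → ℝ}

/-- Finitely many small neighbourhoods, of centres `c`, cover the closure of the half ball. A point
of the full ball is reached through a midpoint near some `c`, hence from `c` in time below `r/4 +
r/2`; this is the source of the factor `3/4`. -/
lemma exists_compact_of_forall_forwardBall
    (hδ : Continuous (fun x ↦ (⟨x, δ x⟩ : TangentBundle 𝓘(ℝ, E) S)))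
    (hβ : Continuous β) (hβ_pos : ∀ x, 0 < β x) {x : S} {r : ℝ} (hr : 0 < r)
    (hhalf : ∃ K, IsCompact K ∧ forwardBall δ β x (r / 2) ⊆ K)
    (h : ∀ y ∈ forwardBall δ β x r, ∃ K, IsCompact K ∧ forwardBall δ β y (3 / 4 * r) ⊆ K) :
    ∃ K, IsCompact K ∧ forwardBall δ β x r ⊆ K := by
  obtain ⟨K, hK, hxK⟩ := hhalf
  set A := closure (forwardBall δ β x (r / 2))
  have hA : IsCompact A := hK.of_isClosed_subset isClosed_closure
    (closure_minimal hxK hK.isClosed)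
  choose U hU hUr using fun y ↦ exists_nhds_mem_forwardBall hδ hβ hβ_pos y
    (show 0 < r / 4 by linarith)
  have hAx : ∀ c ∈ A, c ∈ forwardBall δ β x r := fun c hc ↦ by
    obtain ⟨y, hyU, hy⟩ := mem_closure_iff_nhds.1 hc (U c) (hU c)
    obtain ⟨τ, hτ, h'⟩ := mem_forwardBall_trans hy (hUr c y hyU c (mem_of_mem_nhds (hU c)))
    exact ⟨τ, by linarith, h'⟩
  obtain ⟨t, htA, ht⟩ := hA.elim_nhds_subcover U fun c _ ↦ hU c
  have h' : ∀ c, ∃ L, IsCompact L ∧ (c ∈ A → forwardBall δ β c (3 / 4 * r) ⊆ L) := fun c ↦ by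
    by_cases hc : c ∈ A
    · obtain ⟨L, hL, hcL⟩ := h c (hAx c hc)
      exact ⟨L, hL, fun _ ↦ hcL⟩
    · exact ⟨∅, isCompact_empty, fun h ↦ absurd h hc⟩
  choose L hL hcL using h'
  refine ⟨⋃ c ∈ t, L c, t.isCompact_biUnion fun c _ ↦ hL c, fun w hw ↦ ?_⟩
  obtain ⟨y, hy, hyw⟩ := exists_mem_forwardBall_half hβ_pos hw
  obtain ⟨c, hct, hyc⟩ := mem_iUnion₂.1 (ht (subset_closure hy))
  obtain ⟨τ, hτ, hcw⟩ := mem_forwardBall_trans (hUr c c (mem_of_mem_nhds (hU c)) y hyc) hyw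
  exact mem_iUnion₂.2 ⟨c, hct, hcL c (htA c hct) ⟨τ, by linarith, hcw⟩⟩

/-- Halve the radius until the ball becomes relatively compact, as small balls are. At the last
radius `r / 2 ^ k` where this fails, `exists_compact_of_forall_forwardBall` supplies `y`, and
enlarging the radius about `y` to `3/4 * r` preserves non-compactness. -/
lemma exists_reach_of_not_compact [FiniteDimensional ℝ E]
    (hδ : Continuous (fun x ↦ (⟨x, δ x⟩ : TangentBundle 𝓘(ℝ, E) S)))
    (hβ : Continuous β) (hβ_pos : ∀ x, 0 < β x) {x : S} {r : ℝ}
    (h : ¬ ∃ K, IsCompact K ∧ forwardBall δ β x r ⊆ K) :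
    ∃ y τ, τ < r ∧ Reach δ β x y τ ∧
      ¬ ∃ K, IsCompact K ∧ forwardBall δ β y (3 / 4 * r) ⊆ K := by
  have hr : 0 < r := by
    by_contra! hr
    refine h ⟨∅, isCompact_empty, ?_⟩
    rintro w ⟨τ, hτ, hw⟩
    linarith [hw.pos hβ_pos]
  obtain ⟨r₁, hr₁, hK₁⟩ := exists_forwardBall_subset_isCompact hδ hβ hβ_pos x
  have hex : ∃ k : ℕ, ∃ K, IsCompact K ∧ forwardBall δ β x (r / 2 ^ k) ⊆ K := by
    obtain ⟨k, hk⟩ := pow_unbounded_of_one_lt (r / r₁) (one_lt_two (α := ℝ))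
    obtain ⟨K, hK, hsub⟩ := hK₁
    refine ⟨k, K, hK, (forwardBall_mono ?_).trans hsub⟩
    rw [div_le_iff₀ (by positivity)]
    rw [div_lt_iff₀ hr₁] at hk
    linarith
  classical
  obtain ⟨k, hk⟩ : ∃ k, Nat.find hex = k + 1 := by
    refine Nat.exists_eq_succ_of_ne_zero fun h0 ↦ h ?_
    have := Nat.find_spec hex
    rwa [h0, pow_zero, div_one] at this
  have hk1 := Nat.find_spec hex
  have hk0 := Nat.find_min hex (show k < Nat.find hex by omega)
  rw [hk, pow_succ, ← div_div] at hk1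
  have hrk : r / 2 ^ k ≤ r := div_le_self hr.le (one_le_pow₀ one_le_two)
  by_contra! hne
  refine hk0 (exists_compact_of_forall_forwardBall hδ hβ hβ_pos (by positivity) hk1 ?_)
  rintro y ⟨τ, hτ, hxy⟩
  obtain ⟨K, hK, hsub⟩ := hne y τ (hτ.trans_le hrk) hxy
  exact ⟨K, hK, (forwardBall_mono (by linarith)).trans hsub⟩

/-- If `S × {0}` is a Cauchy hypersurface, then forward balls are relatively compact. -/
theorem exists_isCompact_forwardBall_subset [FiniteDimensional ℝ E]
    (hδ : Continuous (fun x ↦ (⟨x, δ x⟩ : TangentBundle 𝓘(ℝ, E) S)))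
    (hβ : Continuous β) (hβ_pos : ∀ x, 0 < β x)
    (hCauchy : IsCauchyHypersurface δ β {z : S × ℝ | z.2 = 0}) (x : S) (r : ℝ) :
    ∃ K, IsCompact K ∧ forwardBall δ β x r ⊆ K := by
  by_contra hx
  set P : S × ℝ → Prop := fun p ↦ ¬ ∃ K, IsCompact K ∧ forwardBall δ β p.1 p.2 ⊆ K with hP
  have hstep : ∀ p : {p // P p}, ∃ y τ, τ < p.1.2 ∧ Reach δ β p.1.1 y τ ∧ P (y, 3 / 4 * p.1.2) :=
    fun p ↦ exists_reach_of_not_compact hδ hβ hβ_pos p.2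
  choose f g hg hfg hf using hstep
  set p : ℕ → {p // P p} := fun n ↦ Nat.rec ⟨(x, r), hx⟩ (fun _ q ↦ ⟨(f q, 3 / 4 * q.1.2), hf q⟩) n
  have hpr : ∀ n, (p n).1.2 = (3 / 4) ^ n * r := fun n ↦ by
    induction n with
    | zero => simp [p]
    | succ n ih =>
      have : (p (n + 1)).1.2 = 3 / 4 * (p n).1.2 := rfl
      rw [this, ih, pow_succ]; ring
  have hreach : ∀ k, Reach δ β (p k).1.1 (p (k + 1)).1.1 (g (p k)) := fun k ↦ hfg (p k)
  obtain ⟨X, T, hX, hT, hT0, hXT⟩ := exists_isFutureCurve_of_reach hβ_pos hreach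
  have hrpos : 0 < r := ((hreach 0).pos hβ_pos).trans (hg (p 0))
  have hTk : ∀ k : ℕ, T k ≤ 4 * r := fun k ↦ by
    -- The durations are dominated by the geometric series `∑ (3/4)^j r`, with sum `4r`.
    have h1 : ∀ n, ∑ j ∈ Finset.range n, g (p j) ≤ 4 * r - 4 * r * (3 / 4) ^ n := fun n ↦ by
      induction n with
      | zero => simp
      | succ n ih =>
        rw [Finset.sum_range_succ, pow_succ]
        have := (hg (p n)).le
        rw [hpr] at this
        linarith
    rw [hT]
    have : 0 ≤ 4 * r * (3 / 4) ^ k := by positivity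
    linarith [h1 k]
  have hTs : ∀ s, T s < 4 * r := fun s ↦ by
    obtain ⟨k, hk⟩ := exists_nat_gt s
    exact ((hXT s k hk).time_lt hβ_pos).trans_le (hTk k)
  -- Lowering the curve by `4r` keeps its time coordinate negative throughout.
  set γ : ℝ → S × ℝ := fun s ↦ (X s, T s + -(4 * r)) with hγ
  have htimelike : IsTimelikeCurve δ β γ univ := by
    refine ⟨ordConnected_univ, Or.inl fun a _ b _ hab ↦ ?_⟩
    have := ((hXT a b hab).comp_affine (a := a) (b := b) one_pos 0 (-(4 * r)) (by ring)
      (by ring)).isPiecewiseInCone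
    simpa using this
  have hinext : IsInextendible γ univ := by
    constructor
    · intro q hq
      have hnat : Tendsto (fun k : ℕ ↦ (⟨(k : ℝ), mem_univ _⟩ : (univ : Set ℝ))) atTop atTop :=
        tendsto_atTop.2 fun s ↦ (tendsto_natCast_atTop_atTop.eventually_ge_atTop (s : ℝ)).mono
          fun k hk ↦ hk
      have hy : Tendsto (fun k : ℕ ↦ (p k).1.1) atTop (𝓝 q.1) := by
        have := (continuous_fst.tendsto q).comp (hq.comp hnat)
        refine this.congr fun k ↦ ?_
        simp [hγ, hX]
      -- If the vertices converged to `q.1`, their balls, whose radii tend to 0, would eventually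
      -- lie in a relatively compact ball about `q.1`.
      obtain ⟨r₁, hr₁, K, hK, hKr⟩ := exists_forwardBall_subset_isCompact hδ hβ hβ_pos q.1
      obtain ⟨U, hU, hUr⟩ := exists_nhds_mem_forwardBall hδ hβ hβ_pos q.1 (half_pos hr₁)
      have hlim : Tendsto (fun n : ℕ ↦ (3 / 4 : ℝ) ^ n * r) atTop (𝓝 0) := by
        simpa using (tendsto_pow_atTop_nhds_zero_of_lt_one (r := (3 / 4 : ℝ)) (by norm_num)
          (by norm_num)).mul_const r
      obtain ⟨k, hkU, hkr⟩ :=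
        ((hy.eventually hU).and (hlim.eventually_lt_const (half_pos hr₁))).exists
      refine (p k).2 ⟨K, hK, fun w hw ↦ hKr ?_⟩
      have hw' := forwardBall_mono (δ := δ) (β := β) ((hpr k).trans_le hkr.le) hw
      simpa using mem_forwardBall_trans (hUr q.1 (mem_of_mem_nhds hU) _ hkU) hw'
    · intro q hq
      -- Along the vertical half-line the time tends to `-∞`, so there is no past end point.
      have hnat : Tendsto (fun k : ℕ ↦ (⟨-(k : ℝ), mem_univ _⟩ : (univ : Set ℝ))) atTop atBot :=
        tendsto_atBot.2 fun s ↦ ((tendsto_neg_atTop_atBot.comp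
          (tendsto_natCast_atTop_atTop (R := ℝ))).eventually_le_atBot (s : ℝ)).mono
          fun k hk ↦ hk
      have h1 := (continuous_snd.tendsto q).comp (hq.comp hnat)
      have h2 : Tendsto (fun k : ℕ ↦ -(k : ℝ) + -(4 * r)) atTop atBot :=
        tendsto_atBot_add_const_right _ _
          (tendsto_neg_atTop_atBot.comp (tendsto_natCast_atTop_atTop (R := ℝ)))
      refine not_tendsto_nhds_of_tendsto_atBot h2 q.2 (h1.congr fun k ↦ ?_)
      simp [hγ, hT0]
  obtain ⟨s, ⟨-, hs⟩, -⟩ := hCauchy γ univ htimelike hinext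
  have : T s + -(4 * r) = 0 := hs
  linarith [hTs s]

end Completeness

/-! ### Scalar estimates, with `g`, `d`, `b`, `τ`, `c` for ⟨ẋ,ẋ⟩, ⟨δ,ẋ⟩, β(x), ṫ, ⟨ż,K⟩. -/

section RealEstimates

variable {g d b τ : ℝ → ℝ} {c Δ : ℝ}

lemma intervalIntegrable_unit {h : ℝ → ℝ} (hh : ContinuousOn h (Icc 0 1)) :
    IntervalIntegrable h MeasureTheory.volume 0 1 :=
  hh.intervalIntegrable_of_Icc zero_le_one

lemma integral_congr_unit {h k : ℝ → ℝ} (hh : EqOn h k (Icc 0 1)) :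
    ∫ s in (0 : ℝ)..1, h s = ∫ s in (0 : ℝ)..1, k s :=
  intervalIntegral.integral_congr (by rwa [uIcc_of_le zero_le_one])

lemma integral_mono_unit {h k : ℝ → ℝ} (hh : ContinuousOn h (Icc 0 1))
    (hk : ContinuousOn k (Icc 0 1)) (hhk : ∀ s ∈ Icc (0 : ℝ) 1, h s ≤ k s) :
    ∫ s in (0 : ℝ)..1, h s ≤ ∫ s in (0 : ℝ)..1, k s :=
  intervalIntegral.integral_mono_on zero_le_one (intervalIntegrable_unit hh)
    (intervalIntegrable_unit hk) hhk

/-- The time difference in terms of the constant `⟨ż, K⟩`. -/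
lemma integral_div_sub_eq (hd : ContinuousOn d (Icc 0 1)) (hb : ContinuousOn b (Icc 0 1))
    (hb_pos : ∀ s, 0 < b s) (hc : ∀ s ∈ Icc (0 : ℝ) 1, d s - b s * τ s = c)
    (hΔ : ∫ s in (0 : ℝ)..1, τ s = Δ) :
    (∫ s in (0 : ℝ)..1, d s / b s) - Δ = c * ∫ s in (0 : ℝ)..1, 1 / b s := by
  have hne : ∀ s ∈ Icc (0 : ℝ) 1, b s ≠ 0 := fun s _ ↦ (hb_pos s).ne'
  have h1 : ∫ s in (0 : ℝ)..1, τ s = ∫ s in (0 : ℝ)..1, (d s / b s - c * (1 / b s)) :=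
    integral_congr_unit fun s hs ↦ by
      have := hne s hs
      have h2 := hc s hs
      field_simp
      linarith
  have k1 : ContinuousOn (fun s ↦ d s / b s) (Icc 0 1) := hd.div hb hne
  have k2 : ContinuousOn (fun s ↦ c * (1 / b s)) (Icc 0 1) :=
    continuousOn_const.mul (continuousOn_const.div hb hne)
  rw [intervalIntegral.integral_sub (intervalIntegrable_unit k1) (intervalIntegrable_unit k2),
    intervalIntegral.integral_const_mul, hΔ] at h1
  linarith

lemma integral_one_div_pos (hb : ContinuousOn b (Icc 0 1)) (hb_pos : ∀ s, 0 < b s) :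
    0 < ∫ s in (0 : ℝ)..1, 1 / b s :=
  intervalIntegral.intervalIntegral_pos_of_pos
    (intervalIntegrable_unit (continuousOn_const.div hb fun s _ ↦ (hb_pos s).ne'))
    (fun s ↦ one_div_pos.2 (hb_pos s)) one_pos

/-- Substituting `τ = (d − c) / b` gives `2dτ − bτ² = (d² − c²) / b`. -/
lemma integral_lorentz_eq (hg : ContinuousOn g (Icc 0 1)) (hd : ContinuousOn d (Icc 0 1))
    (hb : ContinuousOn b (Icc 0 1)) (hb_pos : ∀ s, 0 < b s)
    (hc : ∀ s ∈ Icc (0 : ℝ) 1, d s - b s * τ s = c) :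
    ∫ s in (0 : ℝ)..1, (g s + 2 * d s * τ s - b s * τ s ^ 2)
      = (∫ s in (0 : ℝ)..1, g s) + (∫ s in (0 : ℝ)..1, d s ^ 2 / b s)
        - c ^ 2 * ∫ s in (0 : ℝ)..1, 1 / b s := by
  have hne : ∀ s ∈ Icc (0 : ℝ) 1, b s ≠ 0 := fun s _ ↦ (hb_pos s).ne'
  have h1 : ContinuousOn (fun s ↦ d s ^ 2 / b s) (Icc 0 1) := (hd.pow 2).div hb hne
  have h2 : ContinuousOn (fun s ↦ c ^ 2 * (1 / b s)) (Icc 0 1) :=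
    continuousOn_const.mul (continuousOn_const.div hb hne)
  have h3 : ContinuousOn (fun s ↦ g s + d s ^ 2 / b s) (Icc 0 1) := hg.add h1
  rw [← intervalIntegral.integral_const_mul,
    ← intervalIntegral.integral_add (intervalIntegrable_unit hg) (intervalIntegrable_unit h1),
    ← intervalIntegral.integral_sub (intervalIntegrable_unit h3)
      (intervalIntegrable_unit h2)]
  refine integral_congr_unit fun s hs ↦ ?_
  have := hne s hs
  simp only [← hc s hs]
  field_simp
  ring

lemma integral_lorentz_eq_reduced (hg : ContinuousOn g (Icc 0 1)) (hd : ContinuousOn d (Icc 0 1))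
    (hb : ContinuousOn b (Icc 0 1)) (hb_pos : ∀ s, 0 < b s)
    (hc : ∀ s ∈ Icc (0 : ℝ) 1, d s - b s * τ s = c) (hΔ : ∫ s in (0 : ℝ)..1, τ s = Δ) :
    (1 / 2) * ∫ s in (0 : ℝ)..1, (g s + 2 * d s * τ s - b s * τ s ^ 2)
      = (1 / 2) * (∫ s in (0 : ℝ)..1, g s) + (1 / 2) * (∫ s in (0 : ℝ)..1, d s ^ 2 / b s)
        - (1 / 2) * ((∫ s in (0 : ℝ)..1, d s / b s) - Δ) ^ 2
          * (∫ s in (0 : ℝ)..1, 1 / b s)⁻¹ := by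
  have hI := integral_one_div_pos hb hb_pos
  rw [integral_lorentz_eq hg hd hb hb_pos hc, integral_div_sub_eq hd hb hb_pos hc hΔ]
  field_simp

/-- Pointwise `2dτ − bτ² = 2cτ + bτ² ≥ 2cτ`. Unlike the exact formula, this loses only a term linear
in `c`. -/
lemma integral_add_le_integral_lorentz (hg : ContinuousOn g (Icc 0 1))
    (hb : ContinuousOn b (Icc 0 1)) (hd : ContinuousOn d (Icc 0 1))
    (hτ : ContinuousOn τ (Icc 0 1)) (hb_pos : ∀ s, 0 < b s)
    (hc : ∀ s ∈ Icc (0 : ℝ) 1, d s - b s * τ s = c) (hΔ : ∫ s in (0 : ℝ)..1, τ s = Δ) :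
    (∫ s in (0 : ℝ)..1, g s) + 2 * c * Δ
      ≤ ∫ s in (0 : ℝ)..1, (g s + 2 * d s * τ s - b s * τ s ^ 2) := by
  have h1 : ContinuousOn (fun s ↦ 2 * c * τ s) (Icc 0 1) := continuousOn_const.mul hτ
  rw [← hΔ, ← intervalIntegral.integral_const_mul,
    ← intervalIntegral.integral_add (intervalIntegrable_unit hg) (intervalIntegrable_unit h1)]
  refine integral_mono_unit (hg.add h1)
    ((hg.add ((continuousOn_const.mul hd).mul hτ)).sub (hb.mul (hτ.pow 2))) fun s hs ↦ ?_
  rw [← hc s hs]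
  nlinarith [mul_nonneg (hb_pos s).le (sq_nonneg (τ s))]

/-- With `G` the square root, `g + d²/b = bG²` and `G ≤ bG²/(2|c|) + |c|/(2b)`. The weight `|c|`
leaves `M/|c| + |c|∫1/b` after integration, whose second term equals `±(∫d/b − Δ)` and so completes
`∫G` to a Fermat length. -/
lemma integral_sqrt_le (hg : ContinuousOn g (Icc 0 1)) (hd : ContinuousOn d (Icc 0 1))
    (hb : ContinuousOn b (Icc 0 1)) (hb_pos : ∀ s, 0 < b s) (hg0 : ∀ s, 0 ≤ g s)
    (hc : ∀ s ∈ Icc (0 : ℝ) 1, d s - b s * τ s = c) {M : ℝ} (hM0 : 0 ≤ M) (hc1 : 1 ≤ |c|)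
    (hM : (1 / 2) * ∫ s in (0 : ℝ)..1, (g s + 2 * d s * τ s - b s * τ s ^ 2) ≤ M) :
    ∫ s in (0 : ℝ)..1, √(g s / b s + (d s / b s) ^ 2) ≤ M + |c| * ∫ s in (0 : ℝ)..1, 1 / b s := by
  have hne : ∀ s ∈ Icc (0 : ℝ) 1, b s ≠ 0 := fun s _ ↦ (hb_pos s).ne'
  have hc0 : 0 < |c| := one_pos.trans_le hc1
  have k1 : ContinuousOn (fun s ↦ 1 / (2 * |c|) * (g s + d s ^ 2 / b s)) (Icc 0 1) :=
    continuousOn_const.mul (hg.add ((hd.pow 2).div hb hne))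
  have k2 : ContinuousOn (fun s ↦ |c| / 2 * (1 / b s)) (Icc 0 1) :=
    continuousOn_const.mul (continuousOn_const.div hb hne)
  have h1 : ∫ s in (0 : ℝ)..1, √(g s / b s + (d s / b s) ^ 2) ≤
      ∫ s in (0 : ℝ)..1, (1 / (2 * |c|) * (g s + d s ^ 2 / b s) + |c| / 2 * (1 / b s)) := by
    refine integral_mono_unit ((hg.div hb hne).add ((hd.div hb hne).pow 2)).sqrt (k1.add k2)
      fun s hs ↦ ?_
    have hb0 := hb_pos s
    set G := √(g s / b s + (d s / b s) ^ 2) with hG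
    have hG2 : G ^ 2 = g s / b s + (d s / b s) ^ 2 :=
      Real.sq_sqrt (add_nonneg (div_nonneg (hg0 s) hb0.le) (sq_nonneg _))
    have h2 : g s + d s ^ 2 / b s = b s * G ^ 2 := by rw [hG2]; field_simp
    have h3 : 1 / (2 * |c|) * (b s * G ^ 2) + |c| / 2 * (1 / b s) - G
        = (b s * G - |c|) ^ 2 / (2 * |c| * b s) := by
      field_simp
      ring
    have h4 : 0 ≤ (b s * G - |c|) ^ 2 / (2 * |c| * b s) := by positivity
    rw [h2]
    linarith
  have k3 : ContinuousOn (fun s ↦ d s ^ 2 / b s) (Icc 0 1) := (hd.pow 2).div hb hne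
  rw [intervalIntegral.integral_add (intervalIntegrable_unit k1) (intervalIntegrable_unit k2),
    intervalIntegral.integral_const_mul, intervalIntegral.integral_const_mul,
    intervalIntegral.integral_add (intervalIntegrable_unit hg) (intervalIntegrable_unit k3)] at h1
  rw [integral_lorentz_eq hg hd hb hb_pos hc, ← sq_abs c] at hM
  set I := ∫ s in (0 : ℝ)..1, 1 / b s
  set Q := (∫ s in (0 : ℝ)..1, g s) + ∫ s in (0 : ℝ)..1, d s ^ 2 / b s
  have h5 : 1 / (2 * |c|) * Q ≤ 1 / (2 * |c|) * (2 * M + |c| ^ 2 * I) :=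
    mul_le_mul_of_nonneg_left (by linarith) (by positivity)
  have h6 : 1 / (2 * |c|) * (2 * M + |c| ^ 2 * I) = M / |c| + |c| / 2 * I := by
    field_simp
  have h7 : M / |c| ≤ M := div_le_self hM0 hc1
  have h8 : (∫ s in (0 : ℝ)..1, √(g s / b s + (d s / b s) ^ 2)) ≤ 1 / (2 * |c|) * Q + |c| / 2 * I :=
    h1
  linarith

/-- The energy is bounded where `b` and `d / b` are controlled. -/
lemma integral_sq_le {v : ℝ → ℝ} (hv : ContinuousOn v (Icc 0 1)) (hd : ContinuousOn d (Icc 0 1))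
    (hb : ContinuousOn b (Icc 0 1)) (hτ : ContinuousOn τ (Icc 0 1)) (hb_pos : ∀ s, 0 < b s)
    (hc : ∀ s ∈ Icc (0 : ℝ) 1, d s - b s * τ s = c) (hΔ : ∫ s in (0 : ℝ)..1, τ s = Δ) {M B D : ℝ}
    (hM : (1 / 2) * ∫ s in (0 : ℝ)..1, (v s ^ 2 + 2 * d s * τ s - b s * τ s ^ 2) ≤ M)
    (hB : ∀ s ∈ Icc (0 : ℝ) 1, b s ≤ B) (hD : ∀ s ∈ Icc (0 : ℝ) 1, |d s / b s| ≤ D * v s) :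
    ∫ s in (0 : ℝ)..1, v s ^ 2 ≤ 4 * M + 4 * B * Δ ^ 2 + 4 * (|Δ| * B * D) ^ 2 := by
  have hne : ∀ s ∈ Icc (0 : ℝ) 1, b s ≠ 0 := fun s _ ↦ (hb_pos s).ne'
  have hB0 : 0 < B := (hb_pos 0).trans_le (hB 0 (by simp))
  have hv2 : ContinuousOn (fun s ↦ v s ^ 2) (Icc 0 1) := hv.pow 2
  have h1 := integral_add_le_integral_lorentz hv2 hb hd hτ hb_pos hc hΔ
  have h2 := integral_div_sub_eq hd hb hb_pos hc hΔ
  have hI : 1 / B ≤ ∫ s in (0 : ℝ)..1, 1 / b s := by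
    have := integral_mono_unit (h := fun _ ↦ 1 / B) continuousOn_const
      (continuousOn_const.div hb hne) fun s hs ↦ one_div_le_one_div_of_le (hb_pos s) (hB s hs)
    simpa using this
  have h3 : |∫ s in (0 : ℝ)..1, d s / b s| ≤ D * ∫ s in (0 : ℝ)..1, v s := by
    rw [← intervalIntegral.integral_const_mul]
    refine (intervalIntegral.abs_integral_le_integral_abs zero_le_one).trans ?_
    exact integral_mono_unit (hd.div hb hne).abs (continuousOn_const.mul hv) hD
  -- From `c ∫1/b = ∫d/b − Δ` and `∫1/b ≥ 1/B`.
  have h4 : |c| ≤ B * (D * (∫ s in (0 : ℝ)..1, v s) + |Δ|) := by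
    have h5 : |c| * (1 / B) ≤ D * (∫ s in (0 : ℝ)..1, v s) + |Δ| := by
      calc |c| * (1 / B) ≤ |c| * ∫ s in (0 : ℝ)..1, 1 / b s :=
            mul_le_mul_of_nonneg_left hI (abs_nonneg c)
        _ = |(∫ s in (0 : ℝ)..1, d s / b s) - Δ| := by
            rw [h2, abs_mul, abs_of_pos (integral_one_div_pos hb hb_pos)]
        _ ≤ _ := (abs_sub _ _).trans (by linarith)
    rw [mul_one_div, div_le_iff₀ hB0] at h5
    linarith
  set κ := |Δ| * B * D
  -- Young's inequality, weighted so that half of the energy remains on the left.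
  have h6 : 2 * κ * ∫ s in (0 : ℝ)..1, v s ≤ (1 / 2) * (∫ s in (0 : ℝ)..1, v s ^ 2) + 2 * κ ^ 2 := by
    have hv3 : ContinuousOn (fun s ↦ (1 / 2) * v s ^ 2) (Icc 0 1) := continuousOn_const.mul hv2
    have := integral_mono_unit (h := fun s ↦ 2 * κ * v s)
      (k := fun s ↦ (1 / 2) * v s ^ 2 + 2 * κ ^ 2) (continuousOn_const.mul hv)
      (hv3.add continuousOn_const)
      fun s _ ↦ by nlinarith [sq_nonneg (v s - 2 * κ)]
    rwa [intervalIntegral.integral_const_mul, intervalIntegral.integral_add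
      (intervalIntegrable_unit hv3) (intervalIntegrable_unit continuousOn_const),
      intervalIntegral.integral_const_mul, intervalIntegral.integral_const, sub_zero,
      one_smul] at this
  have h7 : -(c * Δ) ≤ |c| * |Δ| := by
    rw [← abs_mul]; exact neg_le_abs _
  have h8 := mul_le_mul_of_nonneg_right h4 (abs_nonneg Δ)
  have h9 : B * (D * (∫ s in (0 : ℝ)..1, v s) + |Δ|) * |Δ|
      = κ * (∫ s in (0 : ℝ)..1, v s) + B * Δ ^ 2 := by
    rw [← sq_abs Δ]; simp only [κ]; ring
  linarith

end RealEstimates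

/-! ### The reduced action and the bound on the energy. -/

section Main

variable {E : Type*} [NormedAddCommGroup E] [NormedSpace ℝ E]
  {S : Type*} [EMetricSpace S] [ChartedSpace E S]
  [RiemannianBundle (fun x : S ↦ TangentSpace 𝓘(ℝ, E) x)]
  {δ : (x : S) → TangentSpace 𝓘(ℝ, E) x} {β : S → ℝ}

lemma exists_of_mem_C1K {p q : S × ℝ} {z : ℝ → S × ℝ} (hz : z ∈ C1K δ β p q) :
    ∃ (x : ℝ → S) (t : ℝ → ℝ) (c : ℝ), (∀ s, z s = (x s, t s)) ∧
      ContMDiffOn 𝓘(ℝ, ℝ) 𝓘(ℝ, E) 1 x (Icc 0 1) ∧ ContDiffOn ℝ 1 t (Icc 0 1) ∧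
      x 0 = p.1 ∧ x 1 = q.1 ∧ ∫ s in (0 : ℝ)..1, derivWithin t (Icc 0 1) s = q.2 - p.2 ∧
      ∀ s ∈ Icc (0 : ℝ) 1,
        shift δ (x s) (curveVelocity x 0 1 s) - β (x s) * derivWithin t (Icc 0 1) s = c := by
  obtain ⟨hC, rfl, rfl, c, hc⟩ := hz
  have hx : ContMDiffOn 𝓘(ℝ, ℝ) 𝓘(ℝ, E) 1 (fun s ↦ (z s).1) (Icc 0 1) :=
    contMDiff_fst.comp_contMDiffOn hC
  have ht : ContDiffOn ℝ 1 (fun s ↦ (z s).2) (Icc 0 1) :=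
    contMDiffOn_iff_contDiffOn.1 (contMDiff_snd.comp_contMDiffOn hC)
  refine ⟨fun s ↦ (z s).1, fun s ↦ (z s).2, c, fun s ↦ rfl, hx, ht, rfl, rfl, ?_, fun s hs ↦ ?_⟩
  · refine intervalIntegral.integral_eq_sub_of_hasDerivAt_of_le zero_le_one ht.continuousOn
      (fun s hs ↦ ?_) (intervalIntegrable_unit
        (ht.continuousOn_derivWithin (uniqueDiffOn_Icc one_pos) le_rfl))
    exact ((ht.differentiableOn one_ne_zero s (Ioo_subset_Icc_self hs)).hasDerivWithinAt).hasDerivAt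
      (Icc_mem_nhds hs.1 hs.2)
  · rw [← hc s hs, show velocity z 0 1 s = _ from velocity_prodMk one_pos hs hx ht]
    exact (lorentz_killing _ _ _).symm

lemma action_eq {x : ℝ → S} {t : ℝ → ℝ} (hx : ContMDiffOn 𝓘(ℝ, ℝ) 𝓘(ℝ, E) 1 x (Icc 0 1))
    (ht : ContDiffOn ℝ 1 t (Icc 0 1)) :
    action δ β (fun s ↦ (x s, t s)) = (1 / 2) * ∫ s in (0 : ℝ)..1,
      (speed (x s) (curveVelocity (E := E) x 0 1 s) ^ 2
        + 2 * shift δ (x s) (curveVelocity x 0 1 s) * derivWithin t (Icc 0 1) s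
        - β (x s) * derivWithin t (Icc 0 1) s ^ 2) := by
  unfold action
  congr 1
  refine integral_congr_unit fun s hs ↦ ?_
  simp only
  rw [velocity_prodMk one_pos hs hx ht]
  exact lorentz_self _ _ _

lemma velocityNorm_eq (x : ℝ → S) :
    velocityNorm E x = √(∫ s in (0 : ℝ)..1, speed (x s) (curveVelocity (E := E) x 0 1 s) ^ 2) := by
  simp only [speed_sq]
  rfl

lemma reducedAction_eq (Δ : ℝ) (x : ℝ → S) :
    reducedAction δ β Δ x
      = (1 / 2) * (∫ s in (0 : ℝ)..1, speed (x s) (curveVelocity (E := E) x 0 1 s) ^ 2)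
        + (1 / 2) * (∫ s in (0 : ℝ)..1, shift δ (x s) (curveVelocity x 0 1 s) ^ 2 / β (x s))
        - (1 / 2) * ((∫ s in (0 : ℝ)..1, shift δ (x s) (curveVelocity x 0 1 s) / β (x s)) - Δ) ^ 2
          * (∫ s in (0 : ℝ)..1, 1 / β (x s))⁻¹ := by
  simp only [speed_sq]
  rfl

variable [IsManifold 𝓘(ℝ, E) 1 S]
  [IsContinuousRiemannianBundle E (fun x : S ↦ TangentSpace 𝓘(ℝ, E) x)]

theorem action_eq_reducedAction
    (hδ : Continuous (fun x ↦ (⟨x, δ x⟩ : TangentBundle 𝓘(ℝ, E) S)))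
    (hβ : Continuous β) (hβ_pos : ∀ x, 0 < β x)
    {p q : S × ℝ} {z : ℝ → S × ℝ} (hz : z ∈ C1K δ β p q) :
    action δ β z = reducedAction δ β (q.2 - p.2) (fun s ↦ (z s).1) := by
  obtain ⟨x, t, c, hzx, hx, ht, -, -, hΔ, hc⟩ := exists_of_mem_C1K hz
  obtain rfl : z = fun s ↦ (x s, t s) := funext hzx
  rw [action_eq hx ht, reducedAction_eq]
  exact integral_lorentz_eq_reduced ((continuousOn_speed one_pos hx).pow 2)
    (continuousOn_shift hδ one_pos hx) (hβ.comp_continuousOn hx.continuousOn)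
    (fun s ↦ hβ_pos (x s)) hc hΔ

/-- Initial arcs have no larger Fermat length. The starting point is inserted separately because the
arc at `s = 0` is degenerate. -/
lemma mem_forwardBall_start
    (hδ : Continuous (fun x ↦ (⟨x, δ x⟩ : TangentBundle 𝓘(ℝ, E) S)))
    (hβ : Continuous β) (hβ_pos : ∀ x, 0 < β x)
    {x : ℝ → S} {r : ℝ}
    (hx : ContMDiffOn 𝓘(ℝ, ℝ) 𝓘(ℝ, E) 1 x (Icc 0 1))
    (hr : ∫ s in (0 : ℝ)..1, fermat δ β (x s) (curveVelocity (E := E) x 0 1 s) < r)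
    {s : ℝ} (hs : s ∈ Icc (0 : ℝ) 1) : x s ∈ insert (x 0) (forwardBall δ β (x 0) r) := by
  rcases hs.1.eq_or_lt with rfl | hs0
  · exact mem_insert _ _
  · exact mem_insert_of_mem _ (mem_forwardBall_of_integral_fermat_lt hδ hβ hβ_pos hs0
      (hx.mono (Icc_subset_Icc_right hs.2))
      ((integral_fermat_mono hδ hβ hβ_pos hs0 hs.2 hx).trans_lt hr))

/-- The Fermat metric is not symmetric: running `x` backwards evaluates it on `−ẋ`. -/
lemma mem_forwardBall_end
    (hδ : Continuous (fun x ↦ (⟨x, δ x⟩ : TangentBundle 𝓘(ℝ, E) S)))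
    (hβ : Continuous β) (hβ_pos : ∀ x, 0 < β x)
    {x : ℝ → S} {r : ℝ}
    (hx : ContMDiffOn 𝓘(ℝ, ℝ) 𝓘(ℝ, E) 1 x (Icc 0 1))
    (hr : ∫ s in (0 : ℝ)..1, fermat δ β (x s) (-curveVelocity (E := E) x 0 1 s) < r)
    {s : ℝ} (hs : s ∈ Icc (0 : ℝ) 1) : x s ∈ insert (x 1) (forwardBall δ β (x 1) r) := by
  have hmaps : MapsTo (fun s : ℝ ↦ -1 * s + 1) (Icc 0 1) (Icc 0 1) := fun s hs ↦
    ⟨by linarith [hs.2], by linarith [hs.1]⟩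
  have h := mem_forwardBall_start hδ hβ hβ_pos (r := r) (contMDiffOn_comp_affine (-1) 1 hmaps hx)
    ?_ (hmaps hs)
  · simpa using h
  · refine lt_of_eq_of_lt ?_ hr
    have h1 := intervalIntegral.integral_comp_sub_left (a := 0) (b := 1)
      (fun s ↦ fermat δ β (x s) (-curveVelocity (E := E) x 0 1 s)) 1
    rw [sub_self, sub_zero] at h1
    rw [← h1]
    refine integral_congr_unit fun u hu ↦ ?_
    rw [curveVelocity_comp_affine (-1) 1 one_pos hmaps hu hx, neg_one_smul,
      show -1 * u + 1 = 1 - u by ring]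

/-- Curves of bounded action with `1 ≤ |⟨ż, K⟩|` stay near one of their end points. -/
lemma mem_forwardBall_of_action_le
    (hδ : Continuous (fun x ↦ (⟨x, δ x⟩ : TangentBundle 𝓘(ℝ, E) S)))
    (hβ : Continuous β) (hβ_pos : ∀ x, 0 < β x)
    {x : ℝ → S} {t : ℝ → ℝ} {c Δ M : ℝ}
    (hx : ContMDiffOn 𝓘(ℝ, ℝ) 𝓘(ℝ, E) 1 x (Icc 0 1)) (ht : ContDiffOn ℝ 1 t (Icc 0 1))
    (hΔ : ∫ s in (0 : ℝ)..1, derivWithin t (Icc 0 1) s = Δ)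
    (hc : ∀ s ∈ Icc (0 : ℝ) 1,
        shift δ (x s) (curveVelocity x 0 1 s) - β (x s) * derivWithin t (Icc 0 1) s = c)
    (hM0 : 0 ≤ M) (hM : action δ β (fun s ↦ (x s, t s)) ≤ M) (hc1 : 1 ≤ |c|) {s : ℝ}
    (hs : s ∈ Icc (0 : ℝ) 1) :
    x s ∈ insert (x 0) (forwardBall δ β (x 0) (M + |Δ| + 1)) ∪
      insert (x 1) (forwardBall δ β (x 1) (M + |Δ| + 1)) := by
  have hv := continuousOn_speed one_pos hx
  have hd := continuousOn_shift hδ one_pos hx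
  have hb : ContinuousOn (fun s ↦ β (x s)) (Icc 0 1) := hβ.comp_continuousOn hx.continuousOn
  have hb_pos : ∀ s, 0 < β (x s) := fun s ↦ hβ_pos (x s)
  have hdb : ContinuousOn (fun s ↦ shift δ (x s) (curveVelocity x 0 1 s) / β (x s)) (Icc 0 1) :=
    hd.div hb fun s _ ↦ (hb_pos s).ne'
  have hG : ContinuousOn (fun s ↦ √(speed (x s) (curveVelocity (E := E) x 0 1 s) ^ 2 / β (x s)
      + (shift δ (x s) (curveVelocity x 0 1 s) / β (x s)) ^ 2)) (Icc 0 1) :=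
    (((hv.pow 2).div hb fun s _ ↦ (hb_pos s).ne').add (hdb.pow 2)).sqrt
  rw [action_eq hx ht] at hM
  have h1 := integral_sqrt_le (hv.pow 2) hd hb hb_pos (fun s ↦ sq_nonneg _) hc hM0 hc1 hM
  have h2 := integral_div_sub_eq hd hb hb_pos hc hΔ
  have h3 := neg_abs_le Δ
  have h4 := le_abs_self Δ
  -- The sign of `c` decides the direction: for `c ≥ 0` the bound is on `∫(G − d/b)`, the Fermat
  -- length of the reversed curve, and for `c ≤ 0` on `∫(G + d/b)`, that of `x` itself.
  rcases le_total 0 c with h0 | h0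
  · refine Or.inr (mem_forwardBall_end hδ hβ hβ_pos hx ?_ hs)
    rw [abs_of_nonneg h0] at h1
    have h5 : ∫ s in (0 : ℝ)..1, fermat δ β (x s) (-curveVelocity (E := E) x 0 1 s)
        = ∫ s in (0 : ℝ)..1, (√(speed (x s) (curveVelocity (E := E) x 0 1 s) ^ 2 / β (x s)
          + (shift δ (x s) (curveVelocity x 0 1 s) / β (x s)) ^ 2)
          - shift δ (x s) (curveVelocity x 0 1 s) / β (x s)) :=
      integral_congr_unit fun s _ ↦ by
        simp only [fermat]
        rw [← neg_one_smul ℝ, speed_smul, shift_smul]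
        simp only [abs_neg, abs_one, one_mul, neg_mul, neg_div, neg_sq]
        ring
    rw [h5, intervalIntegral.integral_sub (intervalIntegrable_unit hG)
      (intervalIntegrable_unit hdb)]
    simp only [Pi.pow_apply] at h1
    linarith
  · refine Or.inl (mem_forwardBall_start hδ hβ hβ_pos hx ?_ hs)
    rw [abs_of_nonpos h0] at h1
    simp only [fermat]
    rw [intervalIntegral.integral_add (intervalIntegrable_unit hdb) (intervalIntegrable_unit hG)]
    simp only [Pi.pow_apply] at h1
    linarith

theorem bddAbove_velocityNorm [FiniteDimensional ℝ E] [IsRiemannianManifold 𝓘(ℝ, E) S]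
    (hδ : Continuous (fun x ↦ (⟨x, δ x⟩ : TangentBundle 𝓘(ℝ, E) S)))
    (hβ : Continuous β) (hβ_pos : ∀ x, 0 < β x)
    (hCauchy : IsCauchyHypersurface δ β {z : S × ℝ | z.2 = 0})
    {p q : S × ℝ} {z : ℕ → ℝ → S × ℝ} (hz : ∀ n, z n ∈ C1K δ β p q)
    (hf : BddAbove (range fun n ↦ action δ β (z n))) :
    BddAbove (range fun n ↦ velocityNorm E (fun s ↦ (z n s).1)) := by
  obtain ⟨M', hM'⟩ := hf
  set M := max M' 0
  have hM0 : 0 ≤ M := le_max_right _ _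
  have hM : ∀ n, action δ β (z n) ≤ M := fun n ↦ (hM' (mem_range_self n)).trans (le_max_left _ _)
  set Δ := q.2 - p.2 with hΔdef
  obtain ⟨K₁, hK₁, h₁⟩ := exists_isCompact_forwardBall_subset hδ hβ hβ_pos hCauchy p.1
    (M + |Δ| + 1)
  obtain ⟨K₂, hK₂, h₂⟩ := exists_isCompact_forwardBall_subset hδ hβ hβ_pos hCauchy q.1
    (M + |Δ| + 1)
  have hK := (hK₁.insert p.1).union (hK₂.insert q.1)
  -- This compact set, hence also `B` and `D` below, does not depend on `n`.
  set K := insert p.1 K₁ ∪ insert q.1 K₂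
  obtain ⟨B, hB⟩ := hK.bddAbove_image hβ.continuousOn
  obtain ⟨D, hD⟩ := hK.bddAbove_image
    ((continuous_norm_section hδ).div hβ fun x ↦ (hβ_pos x).ne').continuousOn
  refine ⟨√(max (2 * M + 2 * |Δ|) (4 * M + 4 * B * Δ ^ 2 + 4 * (|Δ| * B * D) ^ 2)), ?_⟩
  rintro _ ⟨n, rfl⟩
  obtain ⟨x, t, c, hzx, hx, ht, hx0, hx1, hΔ, hc⟩ := exists_of_mem_C1K (hz n)
  have hMn := hM n
  have hzn : z n = fun s ↦ (x s, t s) := funext hzx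
  rw [hzn] at hMn
  simp only [hzn]
  rw [velocityNorm_eq]
  refine Real.sqrt_le_sqrt ?_
  have hv := continuousOn_speed one_pos hx
  have hd := continuousOn_shift hδ one_pos hx
  have hb : ContinuousOn (fun s ↦ β (x s)) (Icc 0 1) := hβ.comp_continuousOn hx.continuousOn
  have hb_pos : ∀ s, 0 < β (x s) := fun s ↦ hβ_pos (x s)
  have hτ := ht.continuousOn_derivWithin (uniqueDiffOn_Icc one_pos) le_rfl
  have hact := hMn
  rw [action_eq hx ht] at hact
  -- For `|c| ≤ 1` the linear lower bound on the action suffices; compactness is needed only for `1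
  -- ≤ |c|`.
  rcases le_total 1 |c| with hc1 | hc1
  · refine le_max_of_le_right ?_
    have hxK : ∀ s ∈ Icc (0 : ℝ) 1, x s ∈ K := fun s hs ↦ by
      have := mem_forwardBall_of_action_le hδ hβ hβ_pos hx ht hΔ hc hM0 hMn hc1 hs
      rw [hx0, hx1] at this
      exact union_subset_union (insert_subset_insert h₁) (insert_subset_insert h₂) this
    refine integral_sq_le hv hd hb hτ hb_pos hc hΔ hact
      (fun s hs ↦ hB (mem_image_of_mem _ (hxK s hs))) fun s hs ↦ ?_
    have h3 : ‖δ (x s)‖ / β (x s) ≤ D := hD (mem_image_of_mem _ (hxK s hs))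
    refine le_trans ?_ (mul_le_mul_of_nonneg_right h3 (speed_nonneg _ _))
    rw [abs_div, abs_of_pos (hb_pos s), div_mul_eq_mul_div]
    exact div_le_div_of_nonneg_right (abs_shift_le _ _) (hb_pos s).le
  · refine le_max_of_le_left ?_
    have h1 := integral_add_le_integral_lorentz (hv.pow 2) hb hd hτ hb_pos hc hΔ
    simp only [Pi.pow_apply] at h1
    have h2 : -(c * Δ) ≤ |Δ| := by
      refine (neg_le_abs _).trans ?_
      rw [abs_mul]
      exact mul_le_of_le_one_left (abs_nonneg _) hc1
    linarith

end Main

end Stationary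

end

theorem mainTheorem3
    {E : Type*} [NormedAddCommGroup E] [NormedSpace ℝ E] [FiniteDimensional ℝ E]
    {S : Type*} [EMetricSpace S] [ChartedSpace E S] [IsManifold 𝓘(ℝ, E) ∞ S]
    [RiemannianBundle (fun x : S ↦ TangentSpace 𝓘(ℝ, E) x)]
    [IsContMDiffRiemannianBundle 𝓘(ℝ, E) ∞ E (fun x : S ↦ TangentSpace 𝓘(ℝ, E) x)]
    [IsRiemannianManifold 𝓘(ℝ, E) S]
    [SecondCountableTopology S] [ConnectedSpace S] [CompleteSpace S]
    (δ : (x : S) → TangentSpace 𝓘(ℝ, E) x)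
    (hδ : ContMDiff 𝓘(ℝ, E) (𝓘(ℝ, E).prod 𝓘(ℝ, E)) ∞
      (fun x ↦ (⟨x, δ x⟩ : TangentBundle 𝓘(ℝ, E) S)))
    (β : S → ℝ) (hβ : ContMDiff 𝓘(ℝ, E) 𝓘(ℝ, ℝ) ∞ β) (hβ_pos : ∀ x, 0 < β x)
    (hCauchy : Stationary.IsCauchyHypersurface δ β {z : S × ℝ | z.2 = 0})
    (p q : S × ℝ) (z : ℕ → ℝ → S × ℝ) (hz : ∀ n, z n ∈ Stationary.C1K δ β p q)
    (hf : BddAbove (range fun n ↦ Stationary.action δ β (z n))) :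
    (∀ n, Stationary.action δ β (z n) =
      Stationary.reducedAction δ β (q.2 - p.2) (fun s ↦ (z n s).1)) ∧
    BddAbove (range fun n ↦ Stationary.velocityNorm E (fun s ↦ (z n s).1)) := by
  have : IsContinuousRiemannianBundle E (fun x : S ↦ TangentSpace 𝓘(ℝ, E) x) := by
    obtain ⟨g, hg, hg'⟩ := IsContMDiffRiemannianBundle.exists_contMDiff
      (IB := 𝓘(ℝ, E)) (n := ∞) (F := E) (E := fun x : S ↦ TangentSpace 𝓘(ℝ, E) x)
    exact ⟨g, hg.continuous, hg'⟩
  exact ⟨fun n ↦ Stationary.action_eq_reducedAction hδ.continuous hβ.continuous hβ_pos (hz n),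
    Stationary.bddAbove_velocityNorm hδ.continuous hβ.continuous hβ_pos hCauchy hz hf⟩
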